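/- Let $H$ be a real Hilbert space and let $A:D(A)\subset H\to H$ be closed, densely defined, self-adjoint and positive definite with compact resolvent. Let $(\phi_n)_{n\ge1}\subset D(A)$ be an orthonormal basis of $H$ with $A\phi_n=\lambda_n\phi_n$, $\lambda_1\le\lambda_2\le\cdots$. Let $U$ be a real Hilbert space and $B:U\to H$ bounded and linear; elements of $D(A)$ are regarded as elements of $U$ by means of a linear map $\iota:D(A)\to U$ (the inclusion, if $D(A)\subset U$), which is suppressed in the notation. Let $\delta>0$, $\beta(t)=e^{-\delta t}$ and $0<\gamma<1+\delta$. Put $$\mu_n^\pm=\tfrac12\Big(\lambda_n+\delta\pm\sqrt{(\lambda_n-\delta)^2-4\lambda_n}\Big)\in\mathbb C,$$ let $N$ be the largest $n$ with $\operatorname{Re}\mu_n^+\le\gamma$ or $\operatorname{Re}\mu_n^-\le\gamma$ ($N=0$ if there is none), let $m(\lambda)=\#\{j\le N:\lambda_j=\lambda\}$ and let $M=\max_{j\le N}m(\lambda_j)$ ($M=0$ if $N=0$). Consider the complex matrices $$P=\begin{pmatrix}0&I_N\\-\operatorname{diag}(\lambda_j(1+\delta))&-\operatorname{diag}(\lambda_j+\delta)\end{pmatrix},\qquad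 Q=\begin{pmatrix}0\\C_{NM}\end{pmatrix},\qquad C_{NM}=\big((B\phi_i,\phi_j)\big)_{j\le N,\;i\le M}.$$ Rank assumption: there are an invertible complex $2N\times2N$ matrix $R$ and a matrix $J$ with diagonal $(-\mu_1^+,\dots,-\mu_N^+,-\mu_1^-,\dots,-\mu_N^-)$ such that $P=R^{-1}JR$, where $J$ is diagonal (semisimple eigenvalues) or, for some ordering of its index set, a Jordan matrix (general case), and such that for each $\lambda\in\{\lambda_1,\dots,\lambda_N\}$ the submatrix of $(RQ)^*$ formed by the columns $j\le N$ with $\lambda_j=\lambda$, and likewise the one formed by the columns $N+j$ with $j\le N$, $\lambda_j=\lambda$, has rank $m(\lambda)$. Let $f:[0,\infty)\to H$ belong to $H^1((0,T);H)$ for all $T>0$, with $f(t)\in\operatorname{Range}(B)$ for all $t\ge0$ and $f(t)\to f_e\in\operatorname{Range}(B)$ as $t\to\infty$; let $y_e\in D(A)$ satisfy $(1+\frac1\delta)Ay_e=f_e$, let $g(t)=\frac1\delta e^{-\delta t}Ay_e$, and let $y_0\in H$. Consider the control system translated around $y_e$, $$y'(t)+Ay(t)+\int_0^t\beta(t-s)Ay(s)\,ds=g(t)+f(t)-f_e+B\tilde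 u(t)\quad(t>0),\qquad y(0)=y_0-y_e. \tag{1}$$ A solution of (1) is a function $y\in C([0,\infty);H)\cap C^1((0,\infty);H)$ with this initial value such that, for all $t>0$, $y(t)$ and $\int_0^t\beta(t-s)y(s)\,ds$ are in $D(A)$ and the equation holds, its memory term being read as $A\int_0^t\beta(t-s)y(s)\,ds$. It is classical if $y\in C^1([0,\infty);H)\cap C([0,\infty);D(A))$ and the equation holds as written for all $t\ge0$. For $v=(v_1,\dots,v_M):[0,\infty)\to\mathbb R^M$ put $u(t)=\sum_{i=1}^M v_i(t)\phi_i$, and let $\tilde u:[0,\infty)\to U$ be obtained from $u$ by absorbing the forcing: $$u(t)=\tilde u(t)+\tilde f(t)-\Big(1-\frac{e^{-\delta t}}{1+\delta}\Big)\tilde f_e,\qquad B\tilde f(t)=f(t),\quad B\tilde f_e=f_e .$$ Say that $v$ stabilizes (1) with constant $C$ if such $\tilde u$ exist and, for every such $\tilde u$, system (1) has exactly one solution $y$ on $[0,\infty)$, this $y$ is classical if $y_0\in D(A)$, and $$|y(t)|\le Ce^{-\gamma t}|y_0-y_e|\qquad(t\ge0).$$ Then: (a) For every $T>0$ there is $C>0$,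 independent of $f$, $f_e$, $y_e$, $y_0$, such that for all such data there are $v\in C([0,\infty);\mathbb R^M)$ and $w:[0,\infty)\to\mathbb R^M$, continuous on $[0,T]$, such that $v$ stabilizes (1) with constant $C$ and $$v_i(t)=-\int_t^T\beta(t-s)w_i(s)\,ds\ \ (0\le t<T),\qquad v_i(t)=w_i(t)=0\ \ (t\ge T),\qquad \int_0^T\sum_{i=1}^M|w_i(t)|^2\,dt\le C|y_0-y_e|^2 .$$ (b) There is $C>0$, independent of $f$, $f_e$, $y_e$, $y_0$, such that for all such data there is $v\in C^2([0,\infty);\mathbb R^M)$ that stabilizes (1) with constant $C$ and satisfies $$|v_j(t)|+|v_j'(t)|+|v_j''(t)|\le Ce^{-\gamma t}|y_0-y_e|\qquad(t>0,\ j=1,\dots,M).$$ -/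

import Mathlib

open Set Filter Topology MeasureTheory

namespace PIDE

noncomputable section

variable {H U : Type*} [NormedAddCommGroup H] [InnerProductSpace ℝ H] [CompleteSpace H]
  [NormedAddCommGroup U] [InnerProductSpace ℝ U]

/-! ### The operator and its eigenfunctions -/

/-- `A` is closed, densely defined, self-adjoint, positive definite, and
`(r I - A)⁻¹` is a compact operator on `H` for some `r` in the resolvent set. -/
structure IsAdmissibleOperator (A : H →ₗ.[ℝ] H) : Prop where
  closed : A.IsClosed
  dense : Dense (A.domain : Set H)
  selfAdjoint : IsSelfAdjoint A
  posDef : ∀ x : A.domain, x ≠ 0 → 0 < inner ℝ (A x) (x : H)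
  compactResolvent : ∃ (r : ℝ) (K : H →L[ℝ] H), IsCompactOperator K ∧
    (∀ x : A.domain, K (r • (x : H) - A x) = x) ∧
    (∀ z : H, ∃ x : A.domain, (x : H) = K z ∧ r • (x : H) - A x = z)

/-- `φ 0, φ 1, …` is an orthonormal basis of `H` that consists of eigenfunctions of `A`, the
eigenvalues `lam 0 ≤ lam 1 ≤ …` being repeated according to multiplicity. -/
structure IsEigenbasis (A : H →ₗ.[ℝ] H) (φ : ℕ → A.domain) (lam : ℕ → ℝ) : Prop where
  orthonormal : Orthonormal ℝ (fun n => (φ n : H))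
  complete : (Submodule.span ℝ (range fun n => (φ n : H))).topologicalClosure = ⊤
  eigen : ∀ n, A (φ n) = lam n • (φ n : H)
  mono : Monotone lam

/-! ### The kernel -/

/-- The kernel `β(t) = e^{-δ t}`. -/
def beta (δ t : ℝ) : ℝ := Real.exp (-δ * t)

theorem beta_zero (δ : ℝ) : beta δ 0 = 1 := by simp [beta]

/-- `β' + δ β = 0`. -/
theorem hasDerivAt_beta (δ t : ℝ) : HasDerivAt (beta δ) (-δ * beta δ t) t := by
  have h := ((hasDerivAt_id t).const_mul (-δ)).exp
  simp only [id, mul_one] at h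
  rw [mul_comm] at h
  exact h

/-! ### Unstable modes -/

/-- The square root of the (real) discriminant, as a complex number. -/
def sqrtDisc (δ l : ℝ) : ℂ := (((l - δ) ^ 2 - 4 * l : ℝ) : ℂ) ^ ((2 : ℂ)⁻¹)

/-- `μ⁺ = (l + δ + √((l - δ)² - 4 l)) / 2`. -/
def muPlus (δ l : ℝ) : ℂ := ((l + δ : ℝ) + sqrtDisc δ l) / 2

/-- `μ⁻ = (l + δ - √((l - δ)² - 4 l)) / 2`. -/
def muMinus (δ l : ℝ) : ℂ := ((l + δ : ℝ) - sqrtDisc δ l) / 2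

/-- `N = max N₁ N₂`, where `N₁` and `N₂` are the largest positions (counted from one) at which
`Re μ⁺ ≤ γ`, respectively `Re μ⁻ ≤ γ`; it is zero if there is no such position. Eigenvalues are
indexed from zero, so `lam j` stands at position `j + 1`. -/
def numUnstable (δ γ : ℝ) (lam : ℕ → ℝ) : ℕ :=
  max (sSup {n | ∃ j, n = j + 1 ∧ (muPlus δ (lam j)).re ≤ γ})
    (sSup {n | ∃ j, n = j + 1 ∧ (muMinus δ (lam j)).re ≤ γ})

open Classical in
/-- The multiplicity of `l` among `lam 0, …, lam (N - 1)`. -/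
def mult (lam : ℕ → ℝ) (N : ℕ) (l : ℝ) : ℕ := {j ∈ Finset.range N | lam j = l}.card

/-- `M`, the largest multiplicity of the eigenvalues `lam 0, …, lam (N - 1)`. -/
def maxMult (lam : ℕ → ℝ) (N : ℕ) : ℕ := (Finset.range N).sup fun j => mult lam N (lam j)

/-! ### The matrices of the unstable part and the rank assumptions -/

/-- The `N × M` matrix with entry `(B φ_i, φ_j)` in row `j` and column `i`. The map `ι` regards
elements of `D(A)` as elements of the control space. -/
def matC (A : H →ₗ.[ℝ] H) (B : U →L[ℝ] H) (ι : A.domain →ₗ[ℝ] U) (φ : ℕ → A.domain) (N M : ℕ) :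
    Matrix (Fin N) (Fin M) ℂ :=
  Matrix.of fun j i => ((inner ℝ (B (ι (φ i))) (φ j : H) : ℝ) : ℂ)

/-- `P = (0, I; -diag(λ_j (1 + δ)), -diag(λ_j + δ))`, of size `2N`. -/
def matP (δ : ℝ) (lam : ℕ → ℝ) (N : ℕ) : Matrix (Fin N ⊕ Fin N) (Fin N ⊕ Fin N) ℂ :=
  Matrix.fromBlocks 0 1
    (-Matrix.diagonal fun j : Fin N => ((lam j * (1 + δ) : ℝ) : ℂ))
    (-Matrix.diagonal fun j : Fin N => ((lam j + δ : ℝ) : ℂ))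

/-- `Q = (0; C)`, of size `2N × M`. -/
def matQ (A : H →ₗ.[ℝ] H) (B : U →L[ℝ] H) (ι : A.domain →ₗ[ℝ] U) (φ : ℕ → A.domain) (N M : ℕ) :
    Matrix (Fin N ⊕ Fin N) (Fin M) ℂ :=
  Matrix.fromRows 0 (matC A B ι φ N M)

/-- The list `-μ⁺_1, …, -μ⁺_N, -μ⁻_1, …, -μ⁻_N` of the eigenvalues of `P`. -/
def eigList (δ : ℝ) (lam : ℕ → ℝ) (N : ℕ) : Fin N ⊕ Fin N → ℂ :=
  Sum.elim (fun j => -muPlus δ (lam j)) (fun j => -muMinus δ (lam j))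

/-- For `S = R Q` and each eigenvalue `l` among `lam 0, …, lam (N - 1)`, of multiplicity `m`, the
two blocks of `m` columns of `S*` that belong to `l` (one in the first `N` columns, one in the last
`N`) have rank `m`. -/
def BlockRanks (lam : ℕ → ℝ) (N M : ℕ) (S : Matrix (Fin N ⊕ Fin N) (Fin M) ℂ) : Prop :=
  ∀ k : Fin N,
    (S.conjTranspose.submatrix id
      (fun j : {j : Fin N // lam j = lam k} => Sum.inl j.1)).rank = mult lam N (lam k) ∧
    (S.conjTranspose.submatrix id
      (fun j : {j : Fin N // lam j = lam k} => Sum.inr j.1)).rank = mult lam N (lam k)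

/-- The rank assumption for semisimple eigenvalues: `P = R⁻¹ D R` with `D` diagonal, and `R Q`
has blocks of full rank. -/
def SemisimpleRank (A : H →ₗ.[ℝ] H) (B : U →L[ℝ] H) (ι : A.domain →ₗ[ℝ] U) (φ : ℕ → A.domain)
    (lam : ℕ → ℝ) (δ : ℝ) (N M : ℕ) : Prop :=
  ∃ R : Matrix (Fin N ⊕ Fin N) (Fin N ⊕ Fin N) ℂ, IsUnit R ∧
    matP δ lam N = R⁻¹ * Matrix.diagonal (eigList δ lam N) * R ∧
    BlockRanks lam N M (R * matQ A B ι φ N M)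

/-- `J` is a Jordan matrix, for some enumeration of its index set: off the diagonal the only
nonzero entries are ones right above the diagonal, between equal diagonal entries. -/
def IsJordan {n : Type*} [Fintype n] (J : Matrix n n ℂ) : Prop :=
  ∃ e : n ≃ Fin (Fintype.card n), ∀ i j, i ≠ j → J i j ≠ 0 →
    (e j : ℕ) = (e i : ℕ) + 1 ∧ J i j = 1 ∧ J i i = J j j

/-- The rank assumption for general (non-semisimple) eigenvalues: `P = R⁻¹ J R` with a Jordan
matrix `J` whose diagonal lists the eigenvalues, and `R Q` has blocks of full rank. -/
def JordanRank (A : H →ₗ.[ℝ] H) (B : U →L[ℝ] H) (ι : A.domain →ₗ[ℝ] U) (φ : ℕ → A.domain)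
    (lam : ℕ → ℝ) (δ : ℝ) (N M : ℕ) : Prop :=
  ∃ R J : Matrix (Fin N ⊕ Fin N) (Fin N ⊕ Fin N) ℂ, IsUnit R ∧
    IsJordan J ∧ (∀ i, J i i = eigList δ lam N i) ∧
    matP δ lam N = R⁻¹ * J * R ∧
    BlockRanks lam N M (R * matQ A B ι φ N M)

/-! ### Solutions of `y' + A y + ∫₀ᵗ β(t-s) A y(s) ds = F`, `y(0) = x₀` -/

/-- Solutions for an initial value in `H`: continuous on `[0, ∞)`, continuously differentiable on
`(0, ∞)`, with the equation in `H` for all `t > 0`. As `A y` need not be Bochner integrable up to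
`0`, the memory term is written `A ∫₀ᵗ β(t-s) y(s) ds`. -/
def IsSolution (A : H →ₗ.[ℝ] H) (δ : ℝ) (F : ℝ → H) (x₀ : H) (y : ℝ → H) : Prop :=
  ContinuousOn y (Ici 0) ∧ y 0 = x₀ ∧ ContDiffOn ℝ 1 y (Ioi 0) ∧
  ∀ t > 0, ∃ a b : A.domain, (a : H) = y t ∧ (b : H) = ∫ s in (0 : ℝ)..t, beta δ (t - s) • y s ∧
    deriv y t + A a + A b = F t

/-- Classical solutions: `y ∈ C¹([0, ∞); H) ∩ C([0, ∞); D(A))`, with the equation in its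
original form for all `t ≥ 0`. Here `z = A y`. -/
def IsClassicalSolution (A : H →ₗ.[ℝ] H) (δ : ℝ) (F : ℝ → H) (x₀ : H) (y : ℝ → H) : Prop :=
  y 0 = x₀ ∧ ContDiffOn ℝ 1 y (Ici 0) ∧
  ∃ z : ℝ → H, ContinuousOn z (Ici 0) ∧ ∀ t ≥ 0, (y t, z t) ∈ A.graph ∧
    derivWithin y (Ici 0) t + z t + ∫ s in (0 : ℝ)..t, beta δ (t - s) • z s = F t

/-! ### The forced system, translated around its equilibrium -/

/-- `f ∈ H¹((0, T); H)` for all `T > 0` (`f` being the continuous representative), with values in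
the range of `B`; it tends to `fe`, which is in the range of `B` too; and `ye` is the equilibrium,
`(1 + 1/δ) A ye = fe`. -/
structure IsForcing (A : H →ₗ.[ℝ] H) (B : U →L[ℝ] H) (δ : ℝ) (f : ℝ → H) (fe : H)
    (ye : A.domain) : Prop where
  sobolev : ∃ f' : ℝ → H, (∀ T > 0, MemLp f' 2 (volume.restrict (Ioc 0 T))) ∧
    ∀ t ≥ 0, f t = f 0 + ∫ s in (0 : ℝ)..t, f' s
  mem_range : ∀ t ≥ 0, f t ∈ range B
  limit : Tendsto f atTop (𝓝 fe)
  limit_mem_range : fe ∈ range B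
  equilibrium : (1 + 1 / δ) • A ye = fe

/-- The right-hand side `g(t) + f(t) - fe + B ũ(t)` of the translated control system, where
`g(t) = (1/δ) e^{-δ t} A ye`. -/
def translatedRHS (A : H →ₗ.[ℝ] H) (B : U →L[ℝ] H) (δ : ℝ) (f : ℝ → H) (fe : H) (ye : A.domain)
    (ut : ℝ → U) (t : ℝ) : H :=
  ((1 / δ) * Real.exp (-δ * t)) • A ye + f t - fe + B (ut t)

/-- `ut` arises from the control `u` by absorbing the forcing:
`u(t) = ut(t) + f̃(t) - (1 - e^{-δ t} / (1 + δ)) f̃ₑ`, with `B f̃ = f` and `B f̃ₑ = fe`. -/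
def Absorbs (B : U →L[ℝ] H) (δ : ℝ) (f : ℝ → H) (fe : H) (u ut : ℝ → U) : Prop :=
  ∃ (ft : ℝ → U) (fte : U), (∀ t ≥ 0, B (ft t) = f t) ∧ B fte = fe ∧
    ∀ t ≥ 0, u t = ut t + ft t - (1 - Real.exp (-δ * t) / (1 + δ)) • fte

/-- Controls `ut` that arise from `u` exist, and for each of them the translated control system
has exactly one solution on `[0, ∞)`; it decays like `C e^{-γ t} |y₀ - ye|`, and it is a classical
solution if the initial value is in `D(A)`. -/
def Stabilizes (A : H →ₗ.[ℝ] H) (B : U →L[ℝ] H) (δ γ C : ℝ) (f : ℝ → H) (fe : H) (ye : A.domain)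
    (y₀ : H) (u : ℝ → U) : Prop :=
  (∃ ut, Absorbs B δ f fe u ut) ∧
  ∀ ut, Absorbs B δ f fe u ut →
    ∃ y : ℝ → H, IsSolution A δ (translatedRHS A B δ f fe ye ut) (y₀ - ye) y ∧
      (∀ z, IsSolution A δ (translatedRHS A B δ f fe ye ut) (y₀ - ye) z → EqOn z y (Ici 0)) ∧
      (y₀ ∈ A.domain →
        IsClassicalSolution A δ (translatedRHS A B δ f fe ye ut) (y₀ - ye) y) ∧
      ∀ t ≥ 0, ‖y t‖ ≤ C * Real.exp (-γ * t) * ‖y₀ - ye‖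

/-- The control `u(t) = ∑_{i ≤ M} v_i(t) Φ_i` with `Φ_i = φ_i`. -/
def finiteControl {A : H →ₗ.[ℝ] H} (ι : A.domain →ₗ[ℝ] U) (φ : ℕ → A.domain) {M : ℕ}
    (v : Fin M → ℝ → ℝ) (t : ℝ) : U :=
  ∑ i, v i t • ι (φ i)

end

end PIDE

/-! With `z` the convolution of `y` with the kernel, the equation is the system
`y' = -A (y + z) + F`, `z' = y - δ z`, which the eigenbasis splits into planar systems with
characteristic roots `-μ_n^±`. Only the first `N` of them decay too slowly.

The rank assumption makes the rows `(B φ_i, φ_n)_i` that belong to one eigenvalue independent, and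
modes with distinct eigenvalues have no common characteristic root. A functional that annihilates
the orbits of all control vectors can therefore be separated into single modes, where it vanishes:
the slow part is controllable. A Gramian with a weight that vanishes to infinite order at the
time `T` then yields `C²` controls that vanish after `T` and steer the slow modes to zero.

The other modes decay at the rate `γ` by a quadratic Lyapunov function, uniformly in `n`. The
series over all modes converges by bounds on the modes with square summable constants, and it
solves the equation. Functions `w_i` as in (a) are `v_i' + δ v_i`. -/

namespace PIDE

section Series

variable {H : Type*} [NormedAddCommGroup H] [InnerProductSpace ℝ H] (b : HilbertBasis ℕ ℝ H)

/-- The vector `∑ c n • b n` with coefficients `c` in the Hilbert basis `b`; it is the junk value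
`0` unless `c` is square summable. -/
noncomputable def synth (c : ℕ → ℝ) : H := ∑' n, c n • b n

theorem hasSum_synth {c : ℕ → ℝ} (hc : Summable fun n => c n ^ 2) :
    HasSum (fun n => c n • b n) (synth b c) := by
  have hmem : Memℓp c 2 := memℓp_gen (by simpa using hc)
  exact (b.hasSum_repr_symm ⟨c, hmem⟩).summable.hasSum

theorem inner_synth {c : ℕ → ℝ} (hc : Summable fun n => c n ^ 2) (n : ℕ) :
    inner ℝ (b n) (synth b c) = c n := by
  have hsum := (hasSum_synth b hc).mapL (innerSL ℝ (b n))
  have hsingle : HasSum (fun k => innerSL ℝ (b n) (c k • b k)) (c n) := by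
    convert hasSum_single n (f := fun k => innerSL ℝ (b n) (c k • b k)) ?_ using 1
    · simp [b.orthonormal.1 n]
    · intro k hk
      simp [b.orthonormal.2 hk.symm]
  exact hsum.unique hsingle

theorem ext_inner_basis {x y : H} (h : ∀ n, inner ℝ (b n) x = inner ℝ (b n) y) : x = y := by
  apply b.repr.injective
  ext n
  simpa [b.repr_apply_apply] using h n

theorem hasSum_inner_smul (x : H) : HasSum (fun n => inner ℝ (b n) x • b n) x := by
  simpa [b.repr_apply_apply] using b.hasSum_repr x

theorem hasSum_sq_inner (x : H) : HasSum (fun n => inner ℝ (b n) x ^ 2) (‖x‖ ^ 2) := by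
  simpa only [real_inner_self_eq_norm_sq, real_inner_comm, ← sq] using b.hasSum_inner_mul_inner x x

theorem hasSum_sq_add_norm_sq_sub {c : ℕ → ℝ} (hc : Summable fun n => c n ^ 2) (m : ℕ) :
    HasSum (fun k => c (k + m) ^ 2)
      (‖synth b c - ∑ n ∈ Finset.range m, c n • b n‖ ^ 2) := by
  set r := synth b c - ∑ n ∈ Finset.range m, c n • b n with hr
  have hcoeff : ∀ k, inner ℝ (b k) r = if k < m then 0 else c k := by
    intro k
    simp only [hr, inner_sub_right, inner_synth b hc, inner_sum, inner_smul_right,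
      orthonormal_iff_ite.mp b.orthonormal, mul_ite, mul_one, mul_zero, Finset.sum_ite_eq,
      Finset.mem_range]
    split_ifs <;> simp
  have hhead : ∑ n ∈ Finset.range m, inner ℝ (b n) r ^ 2 = 0 :=
    Finset.sum_eq_zero fun n hn => by simp [hcoeff, Finset.mem_range.mp hn]
  have htail := (hasSum_nat_add_iff' m).mpr (hasSum_sq_inner b r)
  rw [hhead, sub_zero] at htail
  simpa [hcoeff] using htail

theorem sq_le_sq_of_abs_le {x y : ℝ} (h : |x| ≤ y) : x ^ 2 ≤ y ^ 2 :=
  sq_le_sq' (abs_le.mp h).1 (abs_le.mp h).2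

theorem summable_sq_of_abs_le {c d : ℕ → ℝ} (hd : Summable fun n => d n ^ 2)
    (h : ∀ n, |c n| ≤ d n) : Summable fun n => c n ^ 2 :=
  hd.of_nonneg_of_le (fun _ => sq_nonneg _) fun n => sq_le_sq_of_abs_le (h n)

theorem summable_sq_add {c d : ℕ → ℝ} (hc : Summable fun n => c n ^ 2)
    (hd : Summable fun n => d n ^ 2) : Summable fun n => (c n + d n) ^ 2 :=
  ((hc.add hd).mul_left 2).of_nonneg_of_le (fun _ => sq_nonneg _) fun _ => add_sq_le

theorem summable_sq_const_mul (r : ℝ) {c : ℕ → ℝ} (hc : Summable fun n => c n ^ 2) :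
    Summable fun n => (r * c n) ^ 2 := by
  simpa [mul_pow] using hc.mul_left (r ^ 2)

theorem summable_sq_abs {c : ℕ → ℝ} (hc : Summable fun n => c n ^ 2) :
    Summable fun n => |c n| ^ 2 := by
  simpa using hc

theorem summable_sq_sum {ι : Type*} (s : Finset ι) {c : ι → ℕ → ℝ}
    (hc : ∀ i, Summable fun n => c i n ^ 2) : Summable fun n => (∑ i ∈ s, c i n) ^ 2 := by
  classical
  induction s using Finset.induction_on with
  | empty => simp
  | insert i s hi ih => simpa [Finset.sum_insert hi] using summable_sq_add (hc i) ih

variable {X : Type*} {S : Set X} {f : X → ℕ → ℝ} {d : ℕ → ℝ}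

theorem tendstoUniformlyOn_synth (hd : Summable fun n => d n ^ 2)
    (hf : ∀ t ∈ S, ∀ n, |f t n| ≤ d n) :
    TendstoUniformlyOn (fun m t => ∑ n ∈ Finset.range m, f t n • b n)
      (fun t => synth b (f t)) atTop S := by
  rw [Metric.tendstoUniformlyOn_iff]
  intro ε hε
  have htail := (tendsto_sum_nat_add fun n => d n ^ 2).eventually (gt_mem_nhds (pow_pos hε 2))
  filter_upwards [htail] with m hm t ht
  have hle : ‖synth b (f t) - ∑ n ∈ Finset.range m, f t n • b n‖ ^ 2 ≤ ∑' k, d (k + m) ^ 2 :=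
    hasSum_le (fun k => sq_le_sq_of_abs_le (hf t ht (k + m)))
      (hasSum_sq_add_norm_sq_sub b (summable_sq_of_abs_le hd (hf t ht)) m)
      ((summable_nat_add_iff m).mpr hd).hasSum
  rw [dist_eq_norm]
  exact lt_of_pow_lt_pow_left₀ 2 hε.le (hle.trans_lt hm)

theorem continuousOn_synth [TopologicalSpace X] (hd : Summable fun n => d n ^ 2)
    (hf : ∀ t ∈ S, ∀ n, |f t n| ≤ d n) (hcont : ∀ n, ContinuousOn (fun t => f t n) S) :
    ContinuousOn (fun t => synth b (f t)) S :=
  (tendstoUniformlyOn_synth b hd hf).continuousOn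
    (Frequently.of_forall fun _ =>
      continuousOn_finsetSum _ fun n _ => (hcont n).smul continuousOn_const)

theorem hasDerivAt_synth {S : Set ℝ} (hS : IsOpen S) {f f' : ℝ → ℕ → ℝ} {d d' : ℕ → ℝ}
    (hd : Summable fun n => d n ^ 2) (hf : ∀ t ∈ S, ∀ n, |f t n| ≤ d n)
    (hd' : Summable fun n => d' n ^ 2) (hf' : ∀ t ∈ S, ∀ n, |f' t n| ≤ d' n)
    (hderiv : ∀ n, ∀ t ∈ S, HasDerivAt (fun t => f t n) (f' t n) t) {t : ℝ} (ht : t ∈ S) :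
    HasDerivAt (fun t => synth b (f t)) (synth b (f' t)) t :=
  hasDerivAt_of_tendstoUniformlyOn hS (tendstoUniformlyOn_synth b hd' hf')
    (Eventually.of_forall fun _ x hx =>
      HasDerivAt.fun_sum fun n _ => (hderiv n x hx).smul_const (b n))
    (fun _ hx => (tendstoUniformlyOn_synth b hd hf).tendsto_at hx) ht

end Series

section Operator

theorem not_isCompact_of_orthonormal_mem {H : Type*} [NormedAddCommGroup H] [InnerProductSpace ℝ H]
    {e : ℕ → H} (he : Orthonormal ℝ e) {s : Set H} (hmem : ∀ n, e n ∈ s) : ¬IsCompact s := by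
  intro hs
  obtain ⟨a, -, g, hg, hlim⟩ := hs.tendsto_subseq hmem
  obtain ⟨m, hm⟩ := Metric.cauchySeq_iff.mp hlim.cauchySeq 1 one_pos
  have hdist : ‖e (g (m + 1)) - e (g m)‖ < 1 := by
    simpa only [dist_eq_norm, Function.comp_apply] using hm (m + 1) (by omega) m le_rfl
  have hsq : ‖e (g (m + 1)) - e (g m)‖ ^ 2 = 2 := by
    rw [norm_sub_sq_real, he.1, he.1, he.2 (hg (Nat.lt_succ_self m)).ne']
    norm_num
  nlinarith [norm_nonneg (e (g (m + 1)) - e (g m))]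

variable {H : Type*} [NormedAddCommGroup H] [InnerProductSpace ℝ H]
  {A : H →ₗ.[ℝ] H} {φ : ℕ → A.domain} {lam : ℕ → ℝ}

namespace IsEigenbasis

theorem exists_hilbertBasis [CompleteSpace H] (hφ : IsEigenbasis A φ lam) :
    ∃ b : HilbertBasis ℕ ℝ H, ∀ n, b n = φ n :=
  ⟨HilbertBasis.mk hφ.orthonormal hφ.complete.ge, fun n => by simp⟩

theorem eigenvalue_pos (hφ : IsEigenbasis A φ lam)
    (hpos : ∀ x : A.domain, x ≠ 0 → 0 < inner ℝ (A x) (x : H)) (n : ℕ) : 0 < lam n := by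
  have hnorm : ‖(φ n : H)‖ = 1 := hφ.orthonormal.1 n
  have hne : φ n ≠ 0 := by
    rintro h
    simp [h] at hnorm
  simpa [hφ.eigen, inner_smul_left, hnorm] using hpos (φ n) hne

theorem tendsto_atTop (hφ : IsEigenbasis A φ lam) {r : ℝ} {K : H →L[ℝ] H}
    (hK : IsCompactOperator K) (hresolvent : ∀ x : A.domain, K (r • (x : H) - A x) = x) :
    Tendsto lam atTop atTop := by
  refine tendsto_atTop_atTop_of_monotone hφ.mono ?_
  by_contra! hbdd
  obtain ⟨L, hL⟩ := hbdd
  have hmem : ∀ n, (φ n : H) ∈ closure (K '' Metric.closedBall 0 (|r| + (|lam 0| + |L|))) := by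
    refine fun n => subset_closure ⟨r • (φ n : H) - A (φ n), ?_, hresolvent (φ n)⟩
    rw [hφ.eigen, ← sub_smul, mem_closedBall_zero_iff, norm_smul, hφ.orthonormal.1 n, mul_one,
      Real.norm_eq_abs]
    have hlower := hφ.mono (Nat.zero_le n)
    have hupper := hL n
    refine (abs_sub r _).trans (add_le_add_right (abs_le.mpr ⟨?_, ?_⟩) _)
    · linarith [neg_abs_le (lam 0), abs_nonneg L]
    · linarith [le_abs_self L, abs_nonneg (lam 0)]
  exact not_isCompact_of_orthonormal_mem hφ.orthonormal hmem
    (hK.isCompact_closure_image_closedBall (f := (K : H →ₗ[ℝ] H)) _)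

theorem inner_apply [CompleteSpace H] (hφ : IsEigenbasis A φ lam)
    (hdense : Dense (A.domain : Set H)) (hself : IsSelfAdjoint A) (x : A.domain) (n : ℕ) :
    inner ℝ (φ n : H) (A x) = lam n * inner ℝ (φ n : H) (x : H) := by
  have hformal := LinearPMap.adjoint_isFormalAdjoint (T := A) hdense
  rw [show LinearPMap.adjoint A = A from hself] at hformal
  rw [← hformal (φ n) x, hφ.eigen, inner_smul_left]
  simp

theorem mem_graph_synth (hφ : IsEigenbasis A φ lam) (hclosed : A.IsClosed)
    {b : HilbertBasis ℕ ℝ H} (hb : ∀ n, b n = φ n) {x : H}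
    (hx : Summable fun n => (lam n * inner ℝ (b n) x) ^ 2) :
    (x, synth b fun n => lam n * inner ℝ (b n) x) ∈ A.graph := by
  have hpartial : ∀ m, (∑ n ∈ Finset.range m, inner ℝ (b n) x • b n,
      ∑ n ∈ Finset.range m, (lam n * inner ℝ (b n) x) • b n) ∈ (A.graph : Set (H × H)) := by
    refine fun m => (LinearPMap.mem_graph_iff A).mpr
      ⟨∑ n ∈ Finset.range m, inner ℝ (b n) x • φ n, by simp [hb], ?_⟩
    rw [← LinearPMap.toFun_eq_coe, map_sum]
    refine Finset.sum_congr rfl fun n _ => ?_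
    rw [map_smul, LinearPMap.toFun_eq_coe, hφ.eigen, hb, smul_smul, mul_comm]
  exact IsClosed.mem_of_tendsto hclosed ((hasSum_inner_smul b x).tendsto_sum_nat.prodMk_nhds
    (hasSum_synth b hx).tendsto_sum_nat) (Eventually.of_forall hpartial)

end IsEigenbasis

end Operator

section ScalarBounds

theorem le_of_hasDerivAt_nonpos {f f' : ℝ → ℝ} (hf : ContinuousOn f (Ici 0))
    (hderiv : ∀ t > 0, HasDerivAt f (f' t) t) {T : ℝ} (hf' : ∀ t, 0 < t → t < T → f' t ≤ 0)
    {t : ℝ} (ht : 0 ≤ t) (htT : t ≤ T) : f t ≤ f 0 := by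
  have hanti : AntitoneOn f (Icc 0 T) := by
    refine antitoneOn_of_hasDerivWithinAt_nonpos (f' := f') (convex_Icc 0 T)
      (hf.mono Icc_subset_Ici_self) ?_ ?_ <;> simp only [interior_Icc]
    · exact fun s hs => (hderiv s hs.1).hasDerivWithinAt
    · exact fun s hs => hf' s hs.1 hs.2
  exact hanti ⟨le_rfl, ht.trans htT⟩ ⟨ht, htT⟩ ht

theorem hasDerivAt_exp_mul_const (k t : ℝ) :
    HasDerivAt (fun t => Real.exp (k * t)) (k * Real.exp (k * t)) t := by
  simpa [mul_comm] using ((hasDerivAt_id t).const_mul k).exp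

theorem exp_neg_mul_mul_exp (k t : ℝ) : Real.exp (-k * t) * Real.exp (k * t) = 1 := by
  rw [← Real.exp_add]
  simp

theorem le_of_hasDerivAt_neg_mul_add {k G T : ℝ} (hk : 0 < k) {w g : ℝ → ℝ}
    (hw : ContinuousOn w (Ici 0)) (hderiv : ∀ t > 0, HasDerivAt w (-k * w t + g t) t)
    (hg : ∀ t, 0 < t → t < T → g t ≤ G) {t : ℝ} (ht : 0 ≤ t) (htT : t ≤ T) :
    w t ≤ Real.exp (-k * t) * (w 0 - G / k) + G / k := by
  have hmono : Real.exp (k * t) * (w t - G / k) ≤ Real.exp (k * 0) * (w 0 - G / k) := by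
    refine le_of_hasDerivAt_nonpos (f := fun t => Real.exp (k * t) * (w t - G / k))
      (f' := fun t => Real.exp (k * t) * (g t - G)) ?_ (fun s hs => ?_) (fun s hs hsT => ?_) ht htT
    · exact (Continuous.continuousOn (by fun_prop)).fun_mul (hw.sub continuousOn_const)
    · refine ((hasDerivAt_exp_mul_const k s).fun_mul
        ((hderiv s hs).sub_const (G / k))).congr_deriv ?_
      field_simp
      ring
    · exact mul_nonpos_of_nonneg_of_nonpos (Real.exp_pos _).le (sub_nonpos.mpr (hg s hs hsT))
  calc w t = Real.exp (-k * t) * (Real.exp (k * t) * (w t - G / k)) + G / k := by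
        rw [← mul_assoc, exp_neg_mul_mul_exp]; ring
    _ ≤ _ := by
        rw [mul_zero, Real.exp_zero, one_mul] at hmono
        gcongr

theorem abs_le_of_hasDerivAt_neg_mul_add {k G T : ℝ} (hk : 0 < k) (hG : 0 ≤ G) {w g : ℝ → ℝ}
    (hw : ContinuousOn w (Ici 0)) (hderiv : ∀ t > 0, HasDerivAt w (-k * w t + g t) t)
    (hg : ∀ t, 0 < t → t < T → |g t| ≤ G) {t : ℝ} (ht : 0 ≤ t) (htT : t ≤ T) :
    |w t| ≤ Real.exp (-k * t) * |w 0| + G / k := by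
  have hforce : 0 ≤ Real.exp (-k * t) * (G / k) := by positivity
  have hupper := le_of_hasDerivAt_neg_mul_add hk hw hderiv
    (fun s hs hsT => (le_abs_self _).trans (hg s hs hsT)) ht htT
  have hlower := le_of_hasDerivAt_neg_mul_add hk hw.neg
    (fun s hs => (hderiv s hs).fun_neg.congr_deriv (g' := -k * -w s + -g s) (by ring))
    (fun s hs hsT => (neg_le_abs _).trans (hg s hs hsT)) ht htT
  have habs := mul_le_mul_of_nonneg_left (le_abs_self (w 0)) (Real.exp_pos (-k * t)).le
  have hneg := mul_le_mul_of_nonneg_left (neg_le_abs (w 0)) (Real.exp_pos (-k * t)).le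
  simp only [mul_sub, Pi.neg_apply] at hupper hlower
  exact abs_le.mpr ⟨by linarith, by linarith⟩

theorem mul_exp_neg_mul_le_inv (l : ℝ) {t : ℝ} (ht : 0 < t) : l * Real.exp (-l * t) ≤ t⁻¹ := by
  rw [neg_mul, Real.exp_neg, ← div_eq_mul_inv, div_le_iff₀ (Real.exp_pos _), inv_mul_eq_div,
    le_div_iff₀ ht]
  linarith [Real.add_one_le_exp (l * t)]

end ScalarBounds

section Mode

/-- The coefficients `y` of a solution and `z` of its convolution with the kernel along one
eigenfunction with eigenvalue `l`: `y' + l y + l z = h`, `y 0 = x` and `z' = y - δ z`, `z 0 = 0`. -/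
structure IsMode (δ l x : ℝ) (h y z : ℝ → ℝ) : Prop where
  continuousOn_fst : ContinuousOn y (Ici 0)
  continuousOn_snd : ContinuousOn z (Ici 0)
  fst_zero : y 0 = x
  snd_zero : z 0 = 0
  hasDerivAt_fst : ∀ t > 0, HasDerivAt y (-l * y t - l * z t + h t) t
  hasDerivAt_snd : ∀ t > 0, HasDerivAt z (y t - δ * z t) t

/-- The quadratic form `(y + (γ - δ) z)² + (l (1 + δ - γ) + γ² - γ δ) z²`. Its coefficients are
chosen so that along a mode it decays at the rate `2 γ`, up to a multiple of `y + (γ - δ) z`. -/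
noncomputable def lyapunov (δ γ l y z : ℝ) : ℝ :=
  (y + (γ - δ) * z) ^ 2 + (l * (1 + δ - γ) + γ ^ 2 - γ * δ) * z ^ 2

theorem sq_le_mul_lyapunov {δ γ l b₀ : ℝ} (hb₀ : 0 < b₀)
    (hb : b₀ ≤ l * (1 + δ - γ) + γ ^ 2 - γ * δ) (y z : ℝ) :
    y ^ 2 ≤ (2 + 2 * (δ - γ) ^ 2 / b₀) * lyapunov δ γ l y z := by
  unfold lyapunov
  set q := l * (1 + δ - γ) + γ ^ 2 - γ * δ
  set p := y + (γ - δ) * z with hp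
  have hsnd : 2 * (δ - γ) ^ 2 * z ^ 2 ≤ 2 * (δ - γ) ^ 2 / b₀ * (q * z ^ 2) := by
    rw [div_mul_eq_mul_div, le_div_iff₀ hb₀]
    calc _ = 2 * (δ - γ) ^ 2 * (b₀ * z ^ 2) := by ring
      _ ≤ _ := by gcongr
  have hcross : 0 ≤ 2 * (δ - γ) ^ 2 / b₀ * p ^ 2 := by positivity
  calc y ^ 2 = (p + (δ - γ) * z) ^ 2 := by rw [hp]; ring
    _ ≤ 2 * (p ^ 2 + ((δ - γ) * z) ^ 2) := add_sq_le
    _ ≤ _ := by nlinarith [mul_nonneg (hb₀.le.trans hb) (sq_nonneg z)]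

/-- The constant in the bounds of the modes on `[0, T]`; what matters is that it does not depend
on the eigenvalue. -/
noncomputable def modeConst (δ T : ℝ) : ℝ := (4 + 2 * (1 + δ) * T) * (1 + T / (2 * δ))

namespace IsMode

variable {δ l x : ℝ} {h y z : ℝ → ℝ}

theorem sub {x' : ℝ} {h' y' z' : ℝ → ℝ} (hm : IsMode δ l x h y z)
    (hm' : IsMode δ l x' h' y' z') :
    IsMode δ l (x - x') (fun t => h t - h' t) (fun t => y t - y' t) (fun t => z t - z' t) where
  continuousOn_fst := hm.continuousOn_fst.sub hm'.continuousOn_fst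
  continuousOn_snd := hm.continuousOn_snd.sub hm'.continuousOn_snd
  fst_zero := by rw [hm.fst_zero, hm'.fst_zero]
  snd_zero := by rw [hm.snd_zero, hm'.snd_zero, sub_zero]
  hasDerivAt_fst t ht :=
    ((hm.hasDerivAt_fst t ht).fun_sub (hm'.hasDerivAt_fst t ht)).congr_deriv (by ring)
  hasDerivAt_snd t ht :=
    ((hm.hasDerivAt_snd t ht).fun_sub (hm'.hasDerivAt_snd t ht)).congr_deriv (by ring)

theorem lyapunov_zero (hm : IsMode δ l x h y z) (γ : ℝ) :
    lyapunov δ γ l (y 0) (z 0) = x ^ 2 := by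
  simp [lyapunov, hm.fst_zero, hm.snd_zero]

theorem continuousOn_lyapunov (hm : IsMode δ l x h y z) (γ : ℝ) :
    ContinuousOn (fun t => lyapunov δ γ l (y t) (z t)) (Ici 0) := by
  have hy := hm.continuousOn_fst
  have hz := hm.continuousOn_snd
  unfold lyapunov
  fun_prop

theorem hasDerivAt_lyapunov (hm : IsMode δ l x h y z) (γ : ℝ) {t : ℝ} (ht : 0 < t) :
    HasDerivAt (fun t => lyapunov δ γ l (y t) (z t))
      (-(2 * γ) * lyapunov δ γ l (y t) (z t) - 2 * (l + δ - 2 * γ) * (y t + (γ - δ) * z t) ^ 2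
        + 2 * (y t + (γ - δ) * z t) * h t) t := by
  have hz := hm.hasDerivAt_snd t ht
  have hmix := (hm.hasDerivAt_fst t ht).fun_add (hz.const_mul (γ - δ))
  refine ((hmix.fun_pow 2).fun_add ((hz.fun_pow 2).const_mul _)).congr_deriv ?_
  unfold lyapunov
  push_cast
  ring

theorem lyapunov_le_of_abs_le (hm : IsMode δ l x h y z) (hδ : 0 < δ) (hl : 0 < l) {T G : ℝ}
    (hh : ∀ t, 0 < t → t < T → |h t| ≤ G) {t : ℝ} (ht : 0 ≤ t) (htT : t ≤ T) :
    lyapunov δ 0 l (y t) (z t) ≤ x ^ 2 + T / (2 * δ) * G ^ 2 := by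
  have hdecr : lyapunov δ 0 l (y t) (z t) - t * (G ^ 2 / (2 * δ)) ≤ x ^ 2 := by
    rw [← hm.lyapunov_zero 0]
    refine (le_of_hasDerivAt_nonpos
      (f := fun t => lyapunov δ 0 l (y t) (z t) - t * (G ^ 2 / (2 * δ)))
      ((hm.continuousOn_lyapunov 0).sub (Continuous.continuousOn (by fun_prop)))
      (fun s hs => (hm.hasDerivAt_lyapunov 0 hs).fun_sub
        ((hasDerivAt_id s).mul_const (G ^ 2 / (2 * δ))))
      (fun s hs hsT => ?_) ht htT).trans_eq (by simp)
    set p := y s + (0 - δ) * z s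
    have hyoung : 2 * p * h s ≤ 2 * δ * p ^ 2 + G ^ 2 / (2 * δ) := by
      have hsquare : 0 ≤ (2 * δ * p - h s) ^ 2 / (2 * δ) := by positivity
      have hforce : h s ^ 2 / (2 * δ) ≤ G ^ 2 / (2 * δ) := by
        exact div_le_div_of_nonneg_right (sq_le_sq_of_abs_le (hh s hs hsT)) (by positivity)
      have hexpand : (2 * δ * p - h s) ^ 2 / (2 * δ)
          = 2 * δ * p ^ 2 - 2 * p * h s + h s ^ 2 / (2 * δ) := by
        field_simp
        ring
      linarith
    linarith [mul_nonneg hl.le (sq_nonneg p)]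
  have htime : t * (G ^ 2 / (2 * δ)) ≤ T * (G ^ 2 / (2 * δ)) := by gcongr
  linarith [show T * (G ^ 2 / (2 * δ)) = T / (2 * δ) * G ^ 2 by ring]

theorem abs_deriv_snd_le (hm : IsMode δ l x h y z) (hδ : 0 < δ) (hl : 0 < l) {T G : ℝ}
    (hG : 0 ≤ G) (hh : ∀ t, 0 < t → t < T → |h t| ≤ G) {t : ℝ} (ht : 0 ≤ t) (htT : t ≤ T) :
    |y t - δ * z t| ≤ (1 + T / (2 * δ)) * (|x| + G) := by
  have hT : 0 ≤ T / (2 * δ) := div_nonneg (ht.trans htT) (by positivity)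
  have hlyap := hm.lyapunov_le_of_abs_le hδ hl hh ht htT
  have hsnd : 0 ≤ l * (1 + δ) * z t ^ 2 := by positivity
  refine abs_le_of_sq_le_sq ?_ (by positivity)
  calc (y t - δ * z t) ^ 2 ≤ lyapunov δ 0 l (y t) (z t) := by
        unfold lyapunov
        linarith
    _ ≤ |x| ^ 2 + T / (2 * δ) * G ^ 2 := by rwa [sq_abs]
    _ ≤ ((1 + T / (2 * δ)) * (|x| + G)) ^ 2 := by
        set c := T / (2 * δ)
        nlinarith [mul_nonneg (abs_nonneg x) hG, mul_nonneg hT (sq_nonneg |x|),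
          mul_nonneg hT (sq_nonneg G), mul_nonneg (mul_nonneg hT hT) (sq_nonneg (|x| + G)),
          mul_nonneg hT (mul_nonneg (abs_nonneg x) hG), sq_nonneg G]

theorem abs_snd_le (hm : IsMode δ l x h y z) (hδ : 0 < δ) (hl : 0 < l) {T G : ℝ}
    (hG : 0 ≤ G) (hh : ∀ t, 0 < t → t < T → |h t| ≤ G) {t : ℝ} (ht : 0 ≤ t) (htT : t ≤ T) :
    |z t| ≤ T * ((1 + T / (2 * δ)) * (|x| + G)) := by
  have hT : 0 ≤ T / (2 * δ) := div_nonneg (ht.trans htT) (by positivity)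
  have hbound : ∀ s ∈ Ico 0 t, ‖y s - δ * z s‖ ≤ (1 + T / (2 * δ)) * (|x| + G) :=
    fun s hs => hm.abs_deriv_snd_le hδ hl hG hh hs.1 (hs.2.le.trans htT)
  rcases ht.eq_or_lt with rfl | ht0
  · rw [hm.snd_zero, abs_zero]
    exact mul_nonneg htT (mul_nonneg (add_nonneg zero_le_one hT) (by positivity))
  obtain ⟨s, hs, hslope⟩ := exists_hasDerivAt_eq_slope z (fun s => y s - δ * z s) ht0
    (hm.continuousOn_snd.mono Icc_subset_Ici_self) fun s hs => hm.hasDerivAt_snd s hs.1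
  rw [hm.snd_zero, sub_zero, sub_zero, eq_div_iff ht0.ne'] at hslope
  rw [← hslope, abs_mul, abs_of_pos ht0, mul_comm]
  exact mul_le_mul htT (hbound s ⟨hs.1.le, hs.2⟩) (abs_nonneg _) (ht.trans htT)

theorem abs_fst_le (hm : IsMode δ l x h y z) (hδ : 0 < δ) (hl : 0 < l) {T G : ℝ}
    (hG : 0 ≤ G) (hh : ∀ t, 0 < t → t < T → |h t| ≤ G) {t : ℝ} (ht : 0 ≤ t) (htT : t ≤ T) :
    |y t| ≤ modeConst δ T * (|x| + G) := by
  have hT0 : 0 ≤ T := ht.trans htT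
  have hderiv := hm.abs_deriv_snd_le hδ hl hG hh ht htT
  have hsnd := hm.abs_snd_le hδ hl hG hh ht htT
  set ρ := (1 + T / (2 * δ)) * (|x| + G) with hρ
  have hρ0 : 0 ≤ ρ := (abs_nonneg _).trans hderiv
  have htri : |y t| ≤ |y t - δ * z t| + δ * |z t| := by
    simpa [abs_mul, abs_of_pos hδ] using abs_add_le (y t - δ * z t) (δ * z t)
  calc |y t| ≤ ρ + δ * (T * ρ) := htri.trans (by gcongr)
    _ ≤ (4 + 2 * (1 + δ) * T) * ρ := by
        linarith [mul_nonneg hT0 hρ0, mul_nonneg hδ.le (mul_nonneg hT0 hρ0)]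
    _ = modeConst δ T * (|x| + G) := by rw [hρ, modeConst]; ring

/-- The sum `y + z` solves `w' = - l w + (z' + h)`, whose solutions gain a factor `1 / l`. -/
theorem mul_abs_add_le_of_deriv_snd (hm : IsMode δ l x h y z) (hl : 0 < l) {T ρ : ℝ} (hρ : 0 ≤ ρ)
    (hbound : ∀ t, 0 < t → t < T → |y t - δ * z t + h t| ≤ ρ) {t : ℝ} (ht : 0 ≤ t) (htT : t ≤ T) :
    l * |y t + z t| ≤ l * Real.exp (-l * t) * |x| + ρ := by
  have hsum := abs_le_of_hasDerivAt_neg_mul_add hl hρ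
    (hm.continuousOn_fst.add hm.continuousOn_snd)
    (fun s hs => ((hm.hasDerivAt_fst s hs).add (hm.hasDerivAt_snd s hs)).congr_deriv
      (g' := -l * (y s + z s) + (y s - δ * z s + h s)) (by ring)) hbound ht htT
  simp only [Pi.add_apply, hm.fst_zero, hm.snd_zero, add_zero] at hsum
  calc l * |y t + z t| ≤ l * (Real.exp (-l * t) * |x| + ρ / l) := by gcongr
    _ = l * Real.exp (-l * t) * |x| + ρ := by field_simp

theorem mul_abs_add_le (hm : IsMode δ l x h y z) (hδ : 0 < δ) (hl : 0 < l) {T G : ℝ}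
    (hG : 0 ≤ G) (hh : ∀ t, 0 < t → t < T → |h t| ≤ G) {t : ℝ} (ht : 0 ≤ t) (htT : t ≤ T) :
    l * |y t + z t| ≤ modeConst δ T * (|x| + G) + l * Real.exp (-l * t) * |x| := by
  have hT0 : 0 ≤ T := ht.trans htT
  set ρ := (1 + T / (2 * δ)) * (|x| + G) with hρ
  have hGρ : G ≤ ρ := by
    have : 0 ≤ T / (2 * δ) * (|x| + G) := by positivity
    linarith [abs_nonneg x]
  have hsum := hm.mul_abs_add_le_of_deriv_snd hl (by positivity : 0 ≤ ρ + G)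
    (fun s hs hsT => (abs_add_le _ _).trans
      (add_le_add (hm.abs_deriv_snd_le hδ hl hG hh hs.le hsT.le) (hh s hs hsT))) ht htT
  have hconst : modeConst δ T * (|x| + G) = (4 + 2 * (1 + δ) * T) * ρ := by
    rw [hρ, modeConst]; ring
  have hρT : 0 ≤ (1 + δ) * T * ρ := by positivity
  linarith

/-- Here `u = l z + (y + z)` solves `u' = -(1 + δ) u + O(1)` uniformly in `l`. -/
theorem mul_abs_snd_le (hm : IsMode δ l x h y z) (hδ : 0 < δ) (hl : 0 < l) {T G : ℝ}
    (hG : 0 ≤ G) (hh : ∀ t, 0 < t → t < T → |h t| ≤ G) {t : ℝ} (ht : 0 ≤ t) (htT : t ≤ T) :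
    l * |z t| ≤ modeConst δ T * (|x| + G) := by
  have hT0 : 0 ≤ T := ht.trans htT
  set ρ := (1 + T / (2 * δ)) * (|x| + G) with hρ
  have hρ0 : 0 ≤ ρ := by positivity
  have hxGρ : |x| + G ≤ ρ := le_mul_of_one_le_left (by positivity)
    (le_add_of_nonneg_right (by positivity))
  have hderiv_snd := fun s hs hsT => hm.abs_deriv_snd_le hδ hl hG hh (t := s) hs hsT
  have hadd : ∀ s, 0 ≤ s → s ≤ T → |y s + z s| ≤ ρ + (1 + δ) * (T * ρ) := by
    intro s hs hsT
    calc |y s + z s| = |(y s - δ * z s) + (1 + δ) * z s| := by ring_nf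
      _ ≤ |y s - δ * z s| + (1 + δ) * |z s| := by
          simpa [abs_mul, abs_of_pos (by linarith : 0 < 1 + δ)] using
            abs_add_le (y s - δ * z s) ((1 + δ) * z s)
      _ ≤ ρ + (1 + δ) * (T * ρ) := by
          gcongr
          exacts [hderiv_snd s hs hsT, hm.abs_snd_le hδ hl hG hh hs hsT]
  have hcomb := abs_le_of_hasDerivAt_neg_mul_add (k := 1 + δ) (T := T)
    (G := (1 + δ) * (ρ + (1 + δ) * (T * ρ)) + (ρ + G)) (by linarith) (by positivity)
    ((continuousOn_const.mul hm.continuousOn_snd).add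
      (hm.continuousOn_fst.add hm.continuousOn_snd))
    (fun s hs => (((hm.hasDerivAt_snd s hs).const_mul l).add
      ((hm.hasDerivAt_fst s hs).add (hm.hasDerivAt_snd s hs))).congr_deriv
      (g' := -(1 + δ) * (l * z s + (y s + z s))
        + ((1 + δ) * (y s + z s) + (y s - δ * z s + h s))) (by ring))
    (fun s hs hsT => (abs_add_le _ _).trans (add_le_add
      (by rw [abs_mul, abs_of_pos (by linarith : 0 < 1 + δ)]; gcongr; exact hadd s hs.le hsT.le)
      ((abs_add_le _ _).trans (add_le_add (hderiv_snd s hs.le hsT.le) (hh s hs hsT))))) ht htT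
  simp only [Pi.add_apply, Pi.mul_apply, hm.fst_zero, hm.snd_zero, mul_zero, add_zero, zero_add]
    at hcomb
  have hexp : Real.exp (-(1 + δ) * t) * |x| ≤ |x| :=
    mul_le_of_le_one_left (abs_nonneg x) (Real.exp_le_one_iff.mpr (by nlinarith))
  have hdiv : ((1 + δ) * (ρ + (1 + δ) * (T * ρ)) + (ρ + G)) / (1 + δ)
      ≤ (ρ + (1 + δ) * (T * ρ)) + (ρ + G) := by
    rw [div_le_iff₀ (by linarith)]
    linarith [mul_nonneg (add_nonneg hρ0 hG) hδ.le]
  calc l * |z t| = |(l * z t + (y t + z t)) - (y t + z t)| := by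
        rw [add_sub_cancel_right, abs_mul, abs_of_pos hl]
    _ ≤ |l * z t + (y t + z t)| + |y t + z t| := abs_sub _ _
    _ ≤ (4 + 2 * (1 + δ) * T) * ρ := by linarith [hadd t ht htT]
    _ = modeConst δ T * (|x| + G) := by rw [hρ, modeConst]; ring

theorem fst_eq (hδ : 0 < δ) (hl : 0 < l) {y' z' : ℝ → ℝ} (hm : IsMode δ l x h y z)
    (hm' : IsMode δ l x h y' z') {t : ℝ} (ht : 0 ≤ t) : y t = y' t := by
  have hbound := (hm.sub hm').abs_fst_le hδ hl le_rfl (by simp) ht le_rfl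
  rw [sub_self, abs_zero, add_zero, mul_zero] at hbound
  exact sub_eq_zero.mp (abs_nonpos_iff.mp hbound)

theorem exp_mul_lyapunov_le (hm : IsMode δ l x h y z) {γ a₀ G : ℝ} (ha₀ : 0 < a₀)
    (ha : a₀ ≤ l + δ - 2 * γ) (hh : ∀ t > 0, |h t| ≤ G * Real.exp (-(γ + 1) * t))
    {t : ℝ} (ht : 0 ≤ t) :
    Real.exp (2 * γ * t) * lyapunov δ γ l (y t) (z t) ≤ x ^ 2 + G ^ 2 / (4 * a₀) := by
  have hdecr := le_of_hasDerivAt_nonpos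
    (f := fun t => Real.exp (2 * γ * t) * lyapunov δ γ l (y t) (z t)
      + G ^ 2 / (4 * a₀) * Real.exp (-2 * t))
    (((Continuous.continuousOn (by fun_prop)).mul (hm.continuousOn_lyapunov γ)).add
      (Continuous.continuousOn (by fun_prop)))
    (fun s hs => ((hasDerivAt_exp_mul_const (2 * γ) s).fun_mul
      (hm.hasDerivAt_lyapunov γ hs)).fun_add ((hasDerivAt_exp_mul_const (-2) s).const_mul _))
    (fun s hs _ => ?_) ht le_rfl
  · simp only [mul_zero, Real.exp_zero, one_mul, mul_one, hm.lyapunov_zero] at hdecr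
    exact (le_add_of_nonneg_right (by positivity)).trans hdecr
  set p := y s + (γ - δ) * z s
  have hyoung : 2 * p * h s - 2 * (l + δ - 2 * γ) * p ^ 2 ≤ h s ^ 2 / (2 * a₀) := by
    rw [le_div_iff₀ (by positivity)]
    have hgap : a₀ * (a₀ * p ^ 2) ≤ (l + δ - 2 * γ) * (a₀ * p ^ 2) := by gcongr
    linarith [sq_nonneg (2 * a₀ * p - h s)]
  have hforce : Real.exp (2 * γ * s) * h s ^ 2 ≤ G ^ 2 * Real.exp (-2 * s) := by
    calc Real.exp (2 * γ * s) * h s ^ 2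
        ≤ Real.exp (2 * γ * s) * (G * Real.exp (-(γ + 1) * s)) ^ 2 := by
          exact mul_le_mul_of_nonneg_left (sq_le_sq_of_abs_le (hh s hs)) (Real.exp_pos _).le
      _ = G ^ 2 * Real.exp (-2 * s) := by
          rw [mul_pow, ← Real.exp_nat_mul, mul_left_comm, ← Real.exp_add]
          congr 2
          push_cast
          ring
  have hyoung' := mul_le_mul_of_nonneg_left hyoung (Real.exp_pos (2 * γ * s)).le
  have hforce' := div_le_div_of_nonneg_right hforce (by positivity : 0 ≤ 2 * a₀)
  have hhalf : G ^ 2 / (4 * a₀) * (-2 * Real.exp (-2 * s))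
      = -(G ^ 2 * Real.exp (-2 * s) / (2 * a₀)) := by field_simp; ring
  rw [hhalf]
  rw [mul_div_assoc'] at hyoung'
  linarith

theorem sq_fst_le_exp (hm : IsMode δ l x h y z) {γ a₀ b₀ G : ℝ} (ha₀ : 0 < a₀) (hb₀ : 0 < b₀)
    (ha : a₀ ≤ l + δ - 2 * γ) (hb : b₀ ≤ l * (1 + δ - γ) + γ ^ 2 - γ * δ)
    (hh : ∀ t > 0, |h t| ≤ G * Real.exp (-(γ + 1) * t)) {t : ℝ} (ht : 0 ≤ t) :
    y t ^ 2 ≤ (2 + 2 * (δ - γ) ^ 2 / b₀) * (x ^ 2 + G ^ 2 / (4 * a₀))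
      * Real.exp (-(2 * γ) * t) := by
  calc y t ^ 2 ≤ (2 + 2 * (δ - γ) ^ 2 / b₀) * lyapunov δ γ l (y t) (z t) :=
        sq_le_mul_lyapunov hb₀ hb _ _
    _ = (2 + 2 * (δ - γ) ^ 2 / b₀) * (Real.exp (2 * γ * t) * lyapunov δ γ l (y t) (z t))
          * Real.exp (-(2 * γ) * t) := by
        linear_combination -((2 + 2 * (δ - γ) ^ 2 / b₀) * lyapunov δ γ l (y t) (z t))
          * exp_neg_mul_mul_exp (2 * γ) t
    _ ≤ _ := by
        gcongr
        exact hm.exp_mul_lyapunov_le ha₀ ha hh ht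

end IsMode

end Mode

/-! ### Linear control systems -/

section Duhamel

variable {E : Type*} [NormedAddCommGroup E] [NormedSpace ℝ E]

/-- The orbit of `e` under the flow of `-L`. A control that acts in the direction `e` at time `s`
on the system `p' = L p` has the same effect as a shift of the initial value along it. -/
noncomputable def backwardOrbit (L : E →L[ℝ] E) (e : E) (s : ℝ) : E :=
  NormedSpace.exp (s • -L) e

/-- The solution of `p' = L p + h e`, `p 0 = x`, by variation of constants. -/
noncomputable def duhamel (L : E →L[ℝ] E) (x e : E) (h : ℝ → ℝ) (t : ℝ) : E :=
  NormedSpace.exp (t • L) (x + ∫ s in (0 : ℝ)..t, h s • backwardOrbit L e s)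

theorem backwardOrbit_zero (L : E →L[ℝ] E) (e : E) : backwardOrbit L e 0 = e := by
  simp [backwardOrbit]

theorem duhamel_zero (L : E →L[ℝ] E) (x e : E) (h : ℝ → ℝ) : duhamel L x e h 0 = x := by
  simp [duhamel]

variable [CompleteSpace E]

theorem hasDerivAt_backwardOrbit (L : E →L[ℝ] E) (e : E) (s : ℝ) :
    HasDerivAt (backwardOrbit L e) (-L (backwardOrbit L e s)) s := by
  have h := (hasDerivAt_exp_smul_const' (-L) s).clm_apply (hasDerivAt_const s e)
  exact h.congr_deriv (by simp [backwardOrbit])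

theorem contDiff_backwardOrbit (L : E →L[ℝ] E) (e : E) {n : WithTop ℕ∞} :
    ContDiff ℝ n (backwardOrbit L e) := by
  have hexp : ContDiff ℝ n (NormedSpace.exp : (E →L[ℝ] E) → _) :=
    AnalyticOnNhd.contDiff fun K _ => NormedSpace.exp_analytic K
  exact (hexp.comp (contDiff_id.smul contDiff_const)).clm_apply contDiff_const

theorem continuous_smul_backwardOrbit (L : E →L[ℝ] E) (e : E) {h : ℝ → ℝ} (hh : Continuous h) :
    Continuous fun s => h s • backwardOrbit L e s :=
  hh.smul (contDiff_backwardOrbit L e (n := 0)).continuous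

theorem exp_smul_backwardOrbit (L : E →L[ℝ] E) (e : E) (t : ℝ) :
    NormedSpace.exp (t • L) (backwardOrbit L e t) = e := by
  let : NormedAlgebra ℚ (E →L[ℝ] E) := NormedAlgebra.restrictScalars ℚ ℝ _
  have hcomm : Commute (t • L) (-(t • L)) := (Commute.refl (t • L)).neg_right
  have hexp := NormedSpace.exp_add_of_commute hcomm
  rw [add_neg_cancel, NormedSpace.exp_zero] at hexp
  rw [backwardOrbit, smul_neg]
  exact (DFunLike.congr_fun hexp e).symm

theorem hasDerivAt_duhamel (L : E →L[ℝ] E) (x e : E) {h : ℝ → ℝ} (hh : Continuous h) (t : ℝ) :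
    HasDerivAt (duhamel L x e h) (L (duhamel L x e h t) + h t • e) t := by
  have hint := ((continuous_smul_backwardOrbit L e hh).integral_hasStrictDerivAt
    0 t).hasDerivAt.const_add x
  refine ((hasDerivAt_exp_smul_const' L t).clm_apply hint).congr_deriv ?_
  rw [map_smul, exp_smul_backwardOrbit]
  rfl

theorem continuous_duhamel (L : E →L[ℝ] E) (x e : E) {h : ℝ → ℝ} (hh : Continuous h) :
    Continuous (duhamel L x e h) :=
  continuous_iff_continuousAt.mpr fun t => (hasDerivAt_duhamel L x e hh t).continuousAt

theorem duhamel_eq_zero {L : E →L[ℝ] E} {x e : E} {T : ℝ} {h : ℝ → ℝ} (hh : Continuous h)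
    (hvanish : ∀ t ≥ T, h t = 0)
    (hsteer : ∫ s in (0 : ℝ)..T, h s • backwardOrbit L e s = -x) {t : ℝ} (ht : T ≤ t) :
    duhamel L x e h t = 0 := by
  have hint := fun a b => (continuous_smul_backwardOrbit L e hh).intervalIntegrable
    (μ := volume) a b
  have htail : ∫ s in T..t, h s • backwardOrbit L e s = 0 := by
    refine intervalIntegral.integral_zero_ae (ae_of_all _ fun s hs => ?_)
    rw [uIoc_of_le ht] at hs
    rw [hvanish s hs.1.le, zero_smul]
  rw [duhamel, ← intervalIntegral.integral_add_adjacent_intervals (hint 0 T) (hint T t), htail,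
    hsteer, add_zero, add_neg_cancel, map_zero]

end Duhamel

section Steering

theorem exists_norm_add_deriv_le {F : Type*} [NormedAddCommGroup F] [NormedSpace ℝ F]
    {T κ : ℝ} (hκ : 0 ≤ κ) {w : ℝ → F} (hw : ContDiff ℝ 2 w) (hvanish : ∀ t ≥ T, w t = 0) :
    ∃ K ≥ 0, ∀ t ≥ 0,
      ‖w t‖ + ‖deriv w t‖ + ‖deriv (deriv w) t‖ ≤ K * Real.exp (-κ * t) := by
  have hcont : Continuous fun t => ‖w t‖ + ‖deriv w t‖ + ‖deriv (deriv w) t‖ := by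
    have hw' : ContDiff ℝ 1 (deriv w) := (contDiff_succ_iff_deriv (n := 1).mp hw).2.2
    exact (hw.continuous.norm.add hw'.continuous.norm).add (hw'.continuous_deriv le_rfl).norm
  obtain ⟨K, hK⟩ := isCompact_Icc.exists_bound_of_continuousOn (hcont.continuousOn (s := Icc 0 T))
  refine ⟨|K| * Real.exp (κ * T), by positivity, fun t ht => ?_⟩
  rw [mul_assoc, ← Real.exp_add]
  rcases le_or_gt t T with htT | htT
  · have hexp : 1 ≤ Real.exp (κ * T + -κ * t) := Real.one_le_exp (by nlinarith)
    calc _ ≤ K := (le_abs_self _).trans (hK t ⟨ht, htT⟩)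
      _ ≤ |K| := le_abs_self K
      _ ≤ _ := le_mul_of_one_le_right (abs_nonneg K) hexp
  · have hzero : w =ᶠ[𝓝 t] fun _ => 0 := by
      filter_upwards [lt_mem_nhds htT] with s hs using hvanish s hs.le
    rw [hzero.deriv.deriv_eq, hzero.deriv_eq, hvanish t htT.le]
    simp only [deriv_const, deriv_const', norm_zero, add_zero]
    positivity

variable {E ι : Type*} [NormedAddCommGroup E] [NormedSpace ℝ E]

/-- The functionals that vanish on all curves `ψ i` before the time `T`: the adjoint states that
controls acting along these curves do not see. -/
def unobservable (T : ℝ) (ψ : ι → ℝ → E) : Submodule ℝ (StrongDual ℝ E) where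
  carrier := {η | ∀ i, ∀ s ∈ Ico 0 T, η (ψ i s) = 0}
  zero_mem' _ _ _ := rfl
  add_mem' hη hζ i s hs := by simp [hη i s hs, hζ i s hs]
  smul_mem' r η hη i s hs := by simp [hη i s hs]

theorem comp_mem_unobservable {T : ℝ} {ψ : ι → ℝ → E} {L : E →L[ℝ] E}
    (hψ : ∀ i s, HasDerivAt (ψ i) (-L (ψ i s)) s) {η : StrongDual ℝ E}
    (hη : η ∈ unobservable T ψ) : η ∘L L ∈ unobservable T ψ := by
  intro i s hs
  have hderiv : HasDerivWithinAt (fun t => η (ψ i t)) (η (-L (ψ i s))) (Ico 0 T) s :=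
    (η.hasFDerivAt.comp_hasDerivAt s (hψ i s)).hasDerivWithinAt
  have hconst : HasDerivWithinAt (fun t => η (ψ i t)) 0 (Ico 0 T) s :=
    (hasDerivWithinAt_const s _ (0 : ℝ)).congr (hη i) (hη i s hs)
  have := (uniqueDiffOn_Ico 0 T s hs).eq_deriv _ hderiv hconst
  rwa [map_neg, neg_eq_zero] at this

variable [Fintype ι]

/-- The controllability Gramian of the curves `ψ i` on `[0, T]`. The weight `expNegInvGlue (T - s)`
makes the controls obtained from it vanish smoothly at `T`. -/
noncomputable def gramian (T : ℝ) {ψ : ι → ℝ → E} (hψ : ∀ i, Continuous (ψ i)) :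
    StrongDual ℝ E →ₗ[ℝ] E where
  toFun η := ∫ s in (0 : ℝ)..T, ∑ i, η (expNegInvGlue (T - s) • ψ i s) • ψ i s
  map_add' η ζ := by
    have hglue : Continuous expNegInvGlue := (expNegInvGlue.contDiff (n := 0)).continuous
    rw [← intervalIntegral.integral_add (Continuous.intervalIntegrable (by fun_prop) _ _)
      (Continuous.intervalIntegrable (by fun_prop) _ _)]
    simp only [add_apply, add_smul, Finset.sum_add_distrib]
  map_smul' r η := by
    simp only [smul_apply, smul_assoc, ← Finset.smul_sum,
      intervalIntegral.integral_smul, RingHom.id_apply]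

theorem apply_gramian [CompleteSpace E] (T : ℝ) {ψ : ι → ℝ → E} (hψ : ∀ i, Continuous (ψ i))
    (η : StrongDual ℝ E) : η (gramian T hψ η) =
      ∫ s in (0 : ℝ)..T, expNegInvGlue (T - s) * ∑ i, η (ψ i s) ^ 2 := by
  have hglue : Continuous expNegInvGlue := (expNegInvGlue.contDiff (n := 0)).continuous
  refine (η.intervalIntegral_comp_comm
    (Continuous.intervalIntegrable (by fun_prop) _ _)).symm.trans ?_
  simp only [map_sum, map_smul, smul_eq_mul, Finset.mul_sum, sq, mul_assoc]

theorem gramian_injective [CompleteSpace E] {T : ℝ} (hT : 0 < T) {ψ : ι → ℝ → E}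
    (hψ : ∀ i, Continuous (ψ i)) (hobs : unobservable T ψ = ⊥) :
    Function.Injective (gramian T hψ) := by
  have hglue : Continuous expNegInvGlue := (expNegInvGlue.contDiff (n := 0)).continuous
  rw [injective_iff_map_eq_zero]
  intro η hη
  have hzero := apply_gramian T hψ η
  rw [hη, map_zero] at hzero
  rw [← Submodule.mem_bot ℝ, ← hobs]
  intro i s hs
  by_contra hne
  have hsum : 0 < ∑ i, η (ψ i s) ^ 2 :=
    Finset.sum_pos' (fun _ _ => sq_nonneg _) ⟨i, Finset.mem_univ i, by positivity⟩
  refine (intervalIntegral.integral_pos hT (Continuous.continuousOn (by fun_prop))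
    (fun t _ => mul_nonneg (expNegInvGlue.nonneg _) (Finset.sum_nonneg fun _ _ => sq_nonneg _))
    ⟨s, Ico_subset_Icc_self hs, ?_⟩).ne hzero
  exact mul_pos (expNegInvGlue.pos_of_pos (sub_pos.mpr hs.2)) hsum

theorem exists_gramian_rightInverse [FiniteDimensional ℝ E] {T : ℝ} (hT : 0 < T)
    {ψ : ι → ℝ → E} (hψ : ∀ i, Continuous (ψ i)) (hobs : unobservable T ψ = ⊥) :
    ∃ S : E →L[ℝ] StrongDual ℝ E, ∀ x, gramian T hψ (S x) = x := by
  have : CompleteSpace E := FiniteDimensional.complete ℝ E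
  have hdim : Module.finrank ℝ (StrongDual ℝ E) = Module.finrank ℝ E :=
    (LinearMap.toContinuousLinearMap (𝕜 := ℝ) (E := E) (F' := ℝ)).symm.finrank_eq.trans
      Subspace.dual_finrank_eq
  let G := (gramian T hψ).linearEquivOfInjective (gramian_injective hT hψ hobs) hdim
  exact ⟨LinearMap.toContinuousLinearMap G.symm.toLinearMap, G.apply_symm_apply⟩

theorem abs_add_abs_deriv_comp_le {F : Type*} [NormedAddCommGroup F] [NormedSpace ℝ F]
    (η : StrongDual ℝ F) {w : ℝ → F} (hw : ContDiff ℝ 2 w) (t : ℝ) :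
    |η (w t)| + |deriv (fun t => η (w t)) t| + |deriv (deriv fun t => η (w t)) t| ≤
      ‖η‖ * (‖w t‖ + ‖deriv w t‖ + ‖deriv (deriv w) t‖) := by
  have hw' : ContDiff ℝ 1 (deriv w) := (contDiff_succ_iff_deriv (n := 1).mp hw).2.2
  have hderiv : deriv (fun t => η (w t)) = fun t => η (deriv w t) := funext fun s =>
    (η.hasFDerivAt.comp_hasDerivAt s (hw.differentiable (by simp) s).hasDerivAt).deriv
  have hderiv' : deriv (fun t => η (deriv w t)) t = η (deriv (deriv w) t) :=
    (η.hasFDerivAt.comp_hasDerivAt t (hw'.differentiable (by simp) t).hasDerivAt).deriv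
  rw [hderiv, hderiv', mul_add, mul_add]
  exact add_le_add (add_le_add (η.le_opNorm _) (η.le_opNorm _)) (η.le_opNorm _)

theorem exists_steering_control [FiniteDimensional ℝ E] {T κ : ℝ} (hT : 0 < T) (hκ : 0 ≤ κ)
    {ψ : ι → ℝ → E} (hψ : ∀ i, ContDiff ℝ 2 (ψ i)) (hobs : unobservable T ψ = ⊥) :
    ∃ K ≥ 0, ∀ x : E, ∃ v : ι → ℝ → ℝ,
      (∀ i, ContDiff ℝ 2 (v i)) ∧ (∀ i, ∀ t ≥ T, v i t = 0) ∧
      ∫ s in (0 : ℝ)..T, ∑ i, v i s • ψ i s = x ∧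
      ∀ i, ∀ t ≥ 0, |v i t| + |deriv (v i) t| + |deriv (deriv (v i)) t| ≤
        K * Real.exp (-κ * t) * ‖x‖ := by
  obtain ⟨S, hS⟩ := exists_gramian_rightInverse hT (fun i => (hψ i).continuous) hobs
  let w : ι → ℝ → E := fun i s => expNegInvGlue (T - s) • ψ i s
  have hw : ∀ i, ContDiff ℝ 2 (w i) := fun i =>
    (expNegInvGlue.contDiff.comp (contDiff_const.sub contDiff_id)).smul (hψ i)
  have hvanish : ∀ i, ∀ t ≥ T, w i t = 0 := fun i t ht => by
    simp only [w, expNegInvGlue.zero_of_nonpos (sub_nonpos.mpr ht), zero_smul]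
  choose K hK₀ hK using fun i => exists_norm_add_deriv_le hκ (hw i) (hvanish i)
  refine ⟨‖S‖ * ∑ i, K i, mul_nonneg (norm_nonneg S) (Finset.sum_nonneg fun i _ => hK₀ i),
    fun x => ⟨fun i t => S x (w i t), fun i => (S x).contDiff.comp (hw i),
      fun i t ht => by simp only [hvanish i t ht, map_zero], hS x, fun i t ht => ?_⟩⟩
  have hKi₀ : 0 ≤ K i := hK₀ i
  have hKi : K i ≤ ∑ j, K j := Finset.single_le_sum (fun j _ => hK₀ j) (Finset.mem_univ i)
  calc _ ≤ ‖S x‖ * (K i * Real.exp (-κ * t)) :=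
        (abs_add_abs_deriv_comp_le (S x) (hw i) t).trans (by gcongr; exact hK i t ht)
    _ ≤ ‖S‖ * ‖x‖ * ((∑ j, K j) * Real.exp (-κ * t)) := by gcongr; exact S.le_opNorm x
    _ = _ := by ring

end Steering

/-! ### Null controllability of finitely many modes -/

section Control

theorem exists_mem_comp_eq {E : Type*} [NormedAddCommGroup E] [NormedSpace ℝ E]
    [FiniteDimensional ℝ E] {D : E →L[ℝ] E} (hD : Function.Surjective D)
    {V : Submodule ℝ (StrongDual ℝ E)} (hV : ∀ ζ ∈ V, ζ ∘L D ∈ V) {η : StrongDual ℝ E}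
    (hη : η ∈ V) : ∃ ζ ∈ V, ζ ∘L D = η := by
  let precomp : StrongDual ℝ E →ₗ[ℝ] StrongDual ℝ E :=
    (ContinuousLinearMap.precomp ℝ D).toLinearMap
  have hinj : Function.Injective precomp := by
    rw [injective_iff_map_eq_zero]
    refine fun ζ hζ => ContinuousLinearMap.ext fun q => ?_
    obtain ⟨p, rfl⟩ := hD q
    exact DFunLike.congr_fun hζ p
  have hmap : V.map precomp = V :=
    Submodule.eq_of_le_of_finrank_eq (Submodule.map_le_iff_le_comap.mpr hV)
      (V.equivMapOfInjective precomp hinj).finrank_eq.symm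
  exact hmap.ge hη

/-- The generator `(-l, -l; 1, -δ)` of one mode. -/
noncomputable def modeGen (δ l : ℝ) : ℝ × ℝ →L[ℝ] ℝ × ℝ :=
  ((-l) • ContinuousLinearMap.fst ℝ ℝ ℝ - l • ContinuousLinearMap.snd ℝ ℝ ℝ).prod
    (ContinuousLinearMap.fst ℝ ℝ ℝ - δ • ContinuousLinearMap.snd ℝ ℝ ℝ)

theorem modeGen_apply (δ l : ℝ) (p : ℝ × ℝ) :
    modeGen δ l p = (-l * p.1 - l * p.2, p.1 - δ * p.2) := rfl

theorem isMode_duhamel (δ l x : ℝ) {h : ℝ → ℝ} (hh : Continuous h) :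
    IsMode δ l x h (fun t => (duhamel (modeGen δ l) (x, 0) (1, 0) h t).1)
      (fun t => (duhamel (modeGen δ l) (x, 0) (1, 0) h t).2) where
  continuousOn_fst := (continuous_duhamel _ _ _ hh).fst.continuousOn
  continuousOn_snd := (continuous_duhamel _ _ _ hh).snd.continuousOn
  fst_zero := by rw [duhamel_zero]
  snd_zero := by rw [duhamel_zero]
  hasDerivAt_fst t _ := (hasFDerivAt_fst.comp_hasDerivAt t
    (hasDerivAt_duhamel _ _ _ hh t)).congr_deriv (by simp [modeGen_apply])
  hasDerivAt_snd t _ := (hasFDerivAt_snd.comp_hasDerivAt t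
    (hasDerivAt_duhamel _ _ _ hh t)).congr_deriv (by simp [modeGen_apply])

/-- The coefficient rows `c j` that belong to one value of `l` are linearly independent. -/
def RowsIndep {ν ι : Type*} [Fintype ν] (l : ν → ℝ) (c : ν → ι → ℝ) : Prop :=
  ∀ k, ∀ ξ : ν → ℝ, (∀ j, l j ≠ l k → ξ j = 0) → (∀ i, ∑ j, c j i * ξ j = 0) → ξ = 0

/-- The joint generator of the modes with eigenvalues `l n`. -/
noncomputable def modesGen {ν : Type*} (δ : ℝ) (l : ν → ℝ) : (ν → ℝ × ℝ) →L[ℝ] ν → ℝ × ℝ :=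
  .pi fun n => modeGen δ (l n) ∘L .proj n

/-- The operator that multiplies the `n`-th mode by `a n`. -/
def modesMul {ν : Type*} (a : ν → ℝ) : (ν → ℝ × ℝ) →L[ℝ] ν → ℝ × ℝ :=
  .pi fun n => a n • .proj n

/-- The backward orbits in the directions of the controls; the `i`-th control acts on the `n`-th
mode with the coefficient `c n i`. -/
noncomputable def modesOrbit {ν ι : Type*} (δ : ℝ) (l : ν → ℝ) (c : ν → ι → ℝ) (i : ι) (s : ℝ) :
    ν → ℝ × ℝ :=
  fun n => c n i • backwardOrbit (modeGen δ (l n)) (1, 0) s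

variable {ν ι : Type*} {δ T κ : ℝ} {l : ν → ℝ} {c : ν → ι → ℝ}

theorem modesGen_add_comp_modesMul (δ : ℝ) (l : ν → ℝ) :
    (modesGen δ l + (1 + δ) • 1) ∘L modesMul l =
      -(modesGen δ l ∘L modesGen δ l + δ • modesGen δ l) := by
  ext p n <;> simp [modesGen, modesMul, modeGen_apply] <;> ring

theorem modesGen_add_surjective (hδ : 0 < δ) (l : ν → ℝ) :
    Function.Surjective (modesGen δ l + (1 + δ) • (1 : (ν → ℝ × ℝ) →L[ℝ] ν → ℝ × ℝ)) := by
  have hne : 1 + δ ≠ 0 := by positivity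
  refine fun q => ⟨fun n => ((1 + δ)⁻¹ * ((q n).1 + l n * (q n).2),
    (1 + δ)⁻¹ * ((1 + δ - l n) * (q n).2 - (q n).1)), ?_⟩
  ext n <;> simp [modesGen, modeGen_apply] <;> field_simp <;> ring

theorem modesMul_single [DecidableEq ν] (a : ν → ℝ) (k : ν) (p : ℝ × ℝ) :
    modesMul a (Pi.single k p) = a k • Pi.single k p := by
  funext n
  rcases eq_or_ne n k with rfl | hnk
  · simp [modesMul]
  · simp [modesMul, hnk]

theorem modesGen_single [DecidableEq ν] (δ : ℝ) (l : ν → ℝ) (k : ν) (p : ℝ × ℝ) :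
    modesGen δ l (Pi.single k p) = Pi.single k (modeGen δ (l k) p) := by
  funext n
  rcases eq_or_ne n k with rfl | hnk
  · simp [modesGen]
  · simp [modesGen, hnk]

theorem single_eq_add_modesGen [DecidableEq ν] (δ : ℝ) (l : ν → ℝ) (k : ν) (p : ℝ × ℝ) :
    (Pi.single k p : ν → ℝ × ℝ) = (p.1 + l k * p.2) • (Pi.single k (1, 0) : ν → ℝ × ℝ) +
      p.2 • modesGen δ l (Pi.single k (1, 0)) := by
  rw [modesGen_single, ← Pi.single_smul', ← Pi.single_smul', ← Pi.single_add]
  congr 1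
  ext
  · simp [modeGen_apply]
    ring
  · simp [modeGen_apply]

theorem modesMul_comp_modesMul (a b : ν → ℝ) :
    modesMul a ∘L modesMul b = modesMul fun n => a n * b n := by
  ext p n <;> simp [modesMul, mul_assoc]

theorem modesMul_sub_const (a : ν → ℝ) (r : ℝ) :
    modesMul (fun n => a n - r) = modesMul a - r • 1 := by
  ext p n <;> simp [modesMul, sub_mul]

theorem hasDerivAt_modesOrbit [Finite ν] (i : ι) (s : ℝ) :
    HasDerivAt (modesOrbit δ l c i) (-modesGen δ l (modesOrbit δ l c i s)) s := by
  have := Fintype.ofFinite ν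
  refine hasDerivAt_pi.mpr fun n => ?_
  refine ((hasDerivAt_backwardOrbit (modeGen δ (l n)) (1, 0) s).const_smul (c n i)).congr_deriv ?_
  simp [modesGen, modesOrbit]

variable [Fintype ν]

theorem contDiff_modesOrbit {k : WithTop ℕ∞} (i : ι) : ContDiff ℝ k (modesOrbit δ l c i) :=
  contDiff_pi.mpr fun n => contDiff_const.fun_smul (contDiff_backwardOrbit (modeGen δ (l n)) _)

theorem comp_modesMul_mem_unobservable (hδ : 0 < δ) {η : StrongDual ℝ (ν → ℝ × ℝ)}
    (hη : η ∈ unobservable T (modesOrbit δ l c)) :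
    η ∘L modesMul l ∈ unobservable T (modesOrbit δ l c) := by
  set V := unobservable T (modesOrbit δ l c)
  have hgen : ∀ ζ ∈ V, ζ ∘L modesGen δ l ∈ V := fun ζ hζ =>
    comp_mem_unobservable hasDerivAt_modesOrbit hζ
  obtain ⟨ζ, hζ, rfl⟩ := exists_mem_comp_eq (modesGen_add_surjective hδ l) (V := V)
    (fun ζ hζ => by
      simpa [ContinuousLinearMap.one_def] using V.add_mem (hgen ζ hζ) (V.smul_mem (1 + δ) hζ)) hη
  have hquad : (ζ ∘L (modesGen δ l + (1 + δ) • 1)) ∘L modesMul l =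
      -((ζ ∘L modesGen δ l) ∘L modesGen δ l + δ • ζ ∘L modesGen δ l) := by
    rw [ContinuousLinearMap.comp_assoc, modesGen_add_comp_modesMul]
    ext p
    simp
  rw [hquad]
  exact V.neg_mem (V.add_mem (hgen _ (hgen ζ hζ)) (V.smul_mem δ (hgen ζ hζ)))

theorem comp_modesMul_prod_mem_unobservable (hδ : 0 < δ) {η : StrongDual ℝ (ν → ℝ × ℝ)}
    (hη : η ∈ unobservable T (modesOrbit δ l c)) (S : Finset ℝ) :
    η ∘L modesMul (fun n => ∏ r ∈ S, (l n - r)) ∈ unobservable T (modesOrbit δ l c) := by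
  classical
  induction S using Finset.induction_on with
  | empty => simpa [modesMul] using hη
  | insert r S hr ih =>
    have hstep := sub_mem (comp_modesMul_mem_unobservable hδ ih) (Submodule.smul_mem _ r ih)
    convert hstep using 1
    simp only [Finset.prod_insert hr, mul_comm (l _ - r)]
    rw [← modesMul_comp_modesMul, modesMul_sub_const]
    ext p
    simp

theorem apply_single_eq_zero_of_unobservable [DecidableEq ν] (hT : 0 < T) (hc : RowsIndep l c)
    {η : StrongDual ℝ (ν → ℝ × ℝ)} (hη : η ∈ unobservable T (modesOrbit δ l c)) {k : ν}
    (hsupp : ∀ j, l j ≠ l k → ∀ p, η (Pi.single j p) = 0) : η (Pi.single k (1, 0)) = 0 := by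
  refine congrFun (hc k (fun j => η (Pi.single j (1, 0))) (fun j hj => hsupp j hj _)
    fun i => ?_) k
  have hzero := hη i 0 ⟨le_rfl, hT⟩
  rw [← Finset.univ_sum_single (modesOrbit δ l c i 0), map_sum] at hzero
  simpa only [modesOrbit, backwardOrbit_zero, Pi.single_smul', map_smul, smul_eq_mul] using hzero

theorem unobservable_modesOrbit (hδ : 0 < δ) (hT : 0 < T) (hc : RowsIndep l c) :
    unobservable T (modesOrbit δ l c) = ⊥ := by
  classical
  refine (Submodule.eq_bot_iff _).mpr fun η hη => ?_
  have hsingle : ∀ k p, η (Pi.single k p) = 0 := by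
    intro k p
    let S := (Finset.univ.image l).erase (l k)
    let a : ν → ℝ := fun n => ∏ r ∈ S, (l n - r)
    have hak : a k ≠ 0 := Finset.prod_ne_zero_iff.mpr fun r hr =>
      sub_ne_zero.mpr (Finset.ne_of_mem_erase hr).symm
    have haj : ∀ j, l j ≠ l k → a j = 0 := fun j hj =>
      Finset.prod_eq_zero (i := l j) (by simp [S, hj]) (sub_self _)
    have hζ := comp_modesMul_prod_mem_unobservable hδ hη S
    set ζ := η ∘L modesMul a
    have hζ_single : ∀ j q, ζ (Pi.single j q) = a j * η (Pi.single j q) := fun j q => by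
      simp only [ζ, ContinuousLinearMap.comp_apply, modesMul_single, map_smul, smul_eq_mul]
    have hfst : ζ (Pi.single k (1, 0)) = 0 :=
      apply_single_eq_zero_of_unobservable hT hc hζ fun j hj q => by
        rw [hζ_single, haj j hj, zero_mul]
    have hsnd : ζ (modesGen δ l (Pi.single k (1, 0))) = 0 :=
      apply_single_eq_zero_of_unobservable hT hc
        (comp_mem_unobservable hasDerivAt_modesOrbit hζ) fun j hj q => by
          rw [ContinuousLinearMap.comp_apply, modesGen_single, hζ_single, haj j hj, zero_mul]
    refine (mul_eq_zero.mp ((hζ_single k p).symm.trans ?_)).resolve_left hak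
    rw [single_eq_add_modesGen δ l, map_add, map_smul, map_smul, hfst, hsnd, smul_zero, smul_zero,
      add_zero]
  refine ContinuousLinearMap.ext fun p => ?_
  rw [← Finset.univ_sum_single p, map_sum]
  exact Finset.sum_eq_zero fun k _ => hsingle k _

theorem exists_null_control [Fintype ι] (hδ : 0 < δ) (hT : 0 < T) (hκ : 0 ≤ κ)
    (hc : RowsIndep l c) :
    ∃ K ≥ 0, ∀ x : ν → ℝ, ∃ v : ι → ℝ → ℝ,
      (∀ i, ContDiff ℝ 2 (v i)) ∧ (∀ i, ∀ t ≥ T, v i t = 0) ∧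
      (∀ n, ∫ s in (0 : ℝ)..T, (∑ i, c n i * v i s) • backwardOrbit (modeGen δ (l n)) (1, 0) s =
        -(x n, 0)) ∧
      ∀ i, ∀ t ≥ 0, |v i t| + |deriv (v i) t| + |deriv (deriv (v i)) t| ≤
        K * Real.exp (-κ * t) * ‖x‖ := by
  obtain ⟨K, hK₀, hK⟩ := exists_steering_control hT hκ
    (fun i => contDiff_modesOrbit (δ := δ) (l := l) (c := c) i) (unobservable_modesOrbit hδ hT hc)
  refine ⟨K, hK₀, fun x => ?_⟩
  obtain ⟨v, hv, hvanish, hsteer, hbound⟩ := hK fun n => -(x n, 0)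
  refine ⟨v, hv, hvanish, fun n => ?_, fun i t ht => (hbound i t ht).trans ?_⟩
  · have hcont : Continuous fun s => ∑ i, v i s • modesOrbit δ l c i s :=
      continuous_finsetSum _ fun i _ =>
        (hv i).continuous.smul (contDiff_modesOrbit (k := 0) i).continuous
    have hproj := (ContinuousLinearMap.proj (R := ℝ) (φ := fun _ : ν => ℝ × ℝ) n
      ).intervalIntegral_comp_comm (hcont.intervalIntegrable (μ := volume) 0 T)
    rw [hsteer, ContinuousLinearMap.proj_apply] at hproj
    rw [← hproj]
    simp [modesOrbit, Finset.sum_smul, smul_smul, mul_comm]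
  · simp [Pi.norm_def]

end Control

/-! ### Characteristic roots and the rank assumptions -/

section Roots

variable {δ γ : ℝ}

theorem sqrtDisc_sq (δ l : ℝ) : sqrtDisc δ l ^ 2 = ((l - δ) ^ 2 - 4 * l : ℝ) := by
  simpa only [sqrtDisc, Nat.cast_ofNat] using
    Complex.cpow_nat_inv_pow (((l - δ) ^ 2 - 4 * l : ℝ) : ℂ) two_ne_zero

theorem muPlus_root (δ l : ℝ) :
    muPlus δ l ^ 2 - (l + δ) * muPlus δ l + l * (1 + δ) = 0 := by
  have hdisc := sqrtDisc_sq δ l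
  rw [muPlus]
  push_cast at hdisc ⊢
  linear_combination hdisc / 4

theorem muMinus_root (δ l : ℝ) :
    muMinus δ l ^ 2 - (l + δ) * muMinus δ l + l * (1 + δ) = 0 := by
  have hdisc := sqrtDisc_sq δ l
  rw [muMinus]
  push_cast at hdisc ⊢
  linear_combination hdisc / 4

theorem eq_of_common_root (hδ : 0 < δ) {l l' : ℝ} {μ : ℂ}
    (h : μ ^ 2 - (l + δ) * μ + l * (1 + δ) = 0)
    (h' : μ ^ 2 - (l' + δ) * μ + l' * (1 + δ) = 0) : l = l' := by
  have hsub : ((l : ℂ) - l') * (1 + δ - μ) = 0 := by linear_combination h - h'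
  rcases mul_eq_zero.mp hsub with hl | hμ
  · exact_mod_cast sub_eq_zero.mp hl
  · have hzero : (1 + δ : ℂ) = 0 := by linear_combination h + (μ + 1 - l) * hμ
    have hzero' : (1 + δ : ℝ) = 0 := by exact_mod_cast hzero
    linarith

theorem muPlus_re (δ l : ℝ) : (muPlus δ l).re = (l + δ + (sqrtDisc δ l).re) / 2 := by
  simp [muPlus]

theorem muMinus_re (δ l : ℝ) : (muMinus δ l).re = (l + δ - (sqrtDisc δ l).re) / 2 := by
  simp [muMinus]

/-- The Routh–Hurwitz criterion for the polynomial whose roots are `μ - γ`. -/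
theorem lt_re_iff (δ γ l : ℝ) :
    (γ < (muPlus δ l).re ∧ γ < (muMinus δ l).re) ↔
      0 < l + δ - 2 * γ ∧ 0 < l * (1 + δ - γ) + γ ^ 2 - γ * δ := by
  rw [muPlus_re, muMinus_re]
  have hre := congrArg Complex.re (sqrtDisc_sq δ l)
  have him := congrArg Complex.im (sqrtDisc_sq δ l)
  rw [sq, Complex.mul_re, Complex.ofReal_re] at hre
  rw [sq, Complex.mul_im, Complex.ofReal_im] at him
  set p := (sqrtDisc δ l).re
  set q := (sqrtDisc δ l).im
  constructor
  · rintro ⟨hplus, hminus⟩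
    exact ⟨by linarith, by nlinarith [sq_nonneg q]⟩
  · rintro ⟨hsum, hprod⟩
    have hp : |p| < l + δ - 2 * γ := by
      have hpq : p * q = 0 := by linarith
      rcases mul_eq_zero.mp hpq with hp₀ | hq₀
      · simpa [hp₀] using hsum
      · rw [hq₀] at hre
        exact abs_lt_of_sq_lt_sq (by nlinarith) hsum.le
    rw [abs_lt] at hp
    constructor <;> linarith

theorem lt_of_sSup_le {g : ℕ → ℝ} (hg : ∀ᶠ n in atTop, γ < g n) {N : ℕ}
    (hN : sSup {n | ∃ j, n = j + 1 ∧ g j ≤ γ} ≤ N) : γ < g N := by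
  obtain ⟨m, hm⟩ := eventually_atTop.mp hg
  have hbdd : BddAbove {n | ∃ j, n = j + 1 ∧ g j ≤ γ} := by
    refine ⟨m, ?_⟩
    rintro _ ⟨j, rfl, hj⟩
    by_contra! hmj
    exact (hm j (by lia)).not_ge hj
  by_contra! hle
  have hsucc : N + 1 ≤ sSup {n | ∃ j, n = j + 1 ∧ g j ≤ γ} := le_csSup hbdd ⟨N, rfl, hle⟩
  lia

theorem lt_re_of_numUnstable (hγδ : γ < 1 + δ) {lam : ℕ → ℝ} (hlam : Tendsto lam atTop atTop) :
    0 < lam (numUnstable δ γ lam) + δ - 2 * γ ∧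
      0 < lam (numUnstable δ γ lam) * (1 + δ - γ) + γ ^ 2 - γ * δ := by
  have hev : ∀ᶠ n in atTop, γ < (muPlus δ (lam n)).re ∧ γ < (muMinus δ (lam n)).re := by
    filter_upwards [hlam.eventually_gt_atTop (2 * γ - δ),
      (hlam.atTop_mul_const (sub_pos.mpr hγδ)).eventually_gt_atTop (γ * δ - γ ^ 2)]
      with n hsum hprod
    exact (lt_re_iff δ γ (lam n)).mpr ⟨by linarith, by linarith⟩
  rw [← lt_re_iff]
  exact ⟨lt_of_sSup_le (g := fun n => (muPlus δ (lam n)).re) (hev.mono fun _ => And.left)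
    (le_max_left _ _), lt_of_sSup_le (g := fun n => (muMinus δ (lam n)).re)
    (hev.mono fun _ => And.right) (le_max_right _ _)⟩

end Roots

section Rank

theorem mulVec_injective_of_card_le_rank {K m n : Type*} [Field K] [Fintype n]
    {C : Matrix m n K} (hC : Fintype.card n ≤ C.rank) : Function.Injective C.mulVec := by
  have hdim := LinearMap.finrank_range_add_finrank_ker C.mulVecLin
  rw [Module.finrank_fintype_fun_eq_card] at hdim
  have hker : Module.finrank K (LinearMap.ker C.mulVecLin) = 0 := by
    rw [Matrix.rank] at hC
    lia
  exact LinearMap.ker_eq_bot.mp (Submodule.finrank_eq_zero.mp hker)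

theorem IsJordan.row_induction {n : Type*} [Fintype n] {J : Matrix n n ℂ} (hJ : IsJordan J)
    {p : n → Prop} (step : ∀ i, (∀ j, i ≠ j → J i j ≠ 0 → p j) → p i) (i : n) :
    p i := by
  obtain ⟨e, he⟩ := hJ
  induction hi : Fintype.card n - (e i : ℕ) using Nat.strong_induction_on generalizing i with
  | _ m ih =>
    refine step i fun j hij hne => ih _ ?_ j rfl
    have := (he i j hij hne).1
    have := (e j).isLt
    lia

theorem IsJordan.diag_eq {n : Type*} [Fintype n] {J : Matrix n n ℂ} (hJ : IsJordan J) {i j : n}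
    (hij : i ≠ j) (hne : J i j ≠ 0) : J i i = J j j := by
  obtain ⟨e, he⟩ := hJ
  exact (he i j hij hne).2.2

variable {lam : ℕ → ℝ} {δ : ℝ} {N : ℕ}

/-- The eigenvalue of `A` to which an entry of `eigList` belongs. -/
def eigOf (lam : ℕ → ℝ) (N : ℕ) : Fin N ⊕ Fin N → ℝ :=
  Sum.elim (fun j => lam j) (fun j => lam j)

theorem eigList_root (i : Fin N ⊕ Fin N) :
    eigList δ lam N i ^ 2 + (eigOf lam N i + δ) * eigList δ lam N i
      + eigOf lam N i * (1 + δ) = 0 := by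
  rcases i with j | j
  · simpa [eigList, eigOf, sub_eq_add_neg] using muPlus_root δ (lam j)
  · simpa [eigList, eigOf, sub_eq_add_neg] using muMinus_root δ (lam j)

theorem eigOf_eq_of_root (hδ : 0 < δ) {i : Fin N ⊕ Fin N} {l : ℝ}
    (hl : eigList δ lam N i ^ 2 + (l + δ) * eigList δ lam N i + l * (1 + δ) = 0) :
    eigOf lam N i = l :=
  eq_of_common_root hδ (μ := -eigList δ lam N i)
    (by linear_combination eigList_root (δ := δ) (lam := lam) i) (by linear_combination hl)

theorem mul_matP_inl (R : Matrix (Fin N ⊕ Fin N) (Fin N ⊕ Fin N) ℂ) (i : Fin N ⊕ Fin N)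
    (k : Fin N) :
    (R * matP δ lam N) i (.inl k) = -(lam k * (1 + δ)) * R i (.inr k) := by
  simp [Matrix.mul_apply, matP, Fintype.sum_sum_type, Matrix.diagonal_apply]
  ring

theorem mul_matP_inr (R : Matrix (Fin N ⊕ Fin N) (Fin N ⊕ Fin N) ℂ) (i : Fin N ⊕ Fin N)
    (k : Fin N) :
    (R * matP δ lam N) i (.inr k) = R i (.inl k) - (lam k + δ) * R i (.inr k) := by
  simp [Matrix.mul_apply, matP, Fintype.sum_sum_type, Matrix.diagonal_apply, Matrix.one_apply]
  ring

theorem row_eq_zero (hδ : 0 < δ) {R J : Matrix (Fin N ⊕ Fin N) (Fin N ⊕ Fin N) ℂ}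
    (hJ : IsJordan J) (hdiag : ∀ i, J i i = eigList δ lam N i)
    (hRP : R * matP δ lam N = J * R) (k : Fin N) (i : Fin N ⊕ Fin N) :
    eigOf lam N i ≠ lam k → R i (.inl k) = 0 ∧ R i (.inr k) = 0 := by
  induction i using hJ.row_induction with
  | step i ih =>
  intro hik
  have hnext : ∀ j, i ≠ j → J i j ≠ 0 → R j (.inl k) = 0 ∧ R j (.inr k) = 0 := by
    intro j hij hne
    have heig : eigList δ lam N j = eigList δ lam N i := by
      rw [← hdiag, ← hdiag, hJ.diag_eq hij hne]
    refine ih j hij hne fun hjk => hik (eigOf_eq_of_root hδ ?_)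
    rw [← heig, ← hjk]
    exact eigList_root j
  have hrow : ∀ c, (∀ j, i ≠ j → J i j ≠ 0 → R j c = 0) →
      (R * matP δ lam N) i c = eigList δ lam N i * R i c := by
    intro c hc
    rw [hRP, Matrix.mul_apply, Finset.sum_eq_single i, hdiag]
    · intro j _ hji
      by_cases hne : J i j = 0
      · rw [hne, zero_mul]
      · rw [hc j hji.symm hne, mul_zero]
    · simp
  have hinl := hrow (.inl k) fun j hij hne => (hnext j hij hne).1
  have hinr := hrow (.inr k) fun j hij hne => (hnext j hij hne).2
  rw [mul_matP_inl] at hinl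
  rw [mul_matP_inr] at hinr
  have hsnd : R i (.inr k) = 0 := by
    by_contra hne
    refine hik (eigOf_eq_of_root hδ ((mul_eq_zero.mp ?_).resolve_left hne))
    linear_combination -hinl - eigList δ lam N i * hinr
  refine ⟨?_, hsnd⟩
  rw [hsnd] at hinr
  linear_combination hinr

theorem card_le_mult (k : Fin N) :
    Fintype.card {j : Fin N // lam j = lam k} ≤ mult lam N (lam k) := by
  classical
  rw [Fintype.card_subtype, mult]
  refine Finset.card_le_card_of_injOn (fun j => (j : ℕ)) (fun j hj => ?_)
    fun a _ b _ h => Fin.ext h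
  simpa using hj

variable {H U : Type*} [NormedAddCommGroup H] [InnerProductSpace ℝ H]
  [NormedAddCommGroup U] [InnerProductSpace ℝ U]
  {A : H →ₗ.[ℝ] H} {B : U →L[ℝ] H} {ι : A.domain →ₗ[ℝ] U} {φ : ℕ → A.domain} {M : ℕ}

theorem SemisimpleRank.jordanRank (h : SemisimpleRank A B ι φ lam δ N M) :
    JordanRank A B ι φ lam δ N M := by
  obtain ⟨R, hR, hP, hS⟩ := h
  exact ⟨R, Matrix.diagonal (eigList δ lam N), hR,
    ⟨Fintype.equivFin _, fun i j hij hne => absurd (Matrix.diagonal_apply_ne _ hij) hne⟩,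
    fun i => by simp, hP, hS⟩

theorem conjTranspose_mul_matQ_apply (R : Matrix (Fin N ⊕ Fin N) (Fin N ⊕ Fin N) ℂ) (i : Fin M)
    (j : Fin N ⊕ Fin N) :
    (R * matQ A B ι φ N M).conjTranspose i j =
      ∑ x, matC A B ι φ N M x i * star (R j (.inr x)) := by
  simp [Matrix.mul_apply, matQ, matC, Fintype.sum_sum_type, mul_comm]

theorem conjTranspose_mul_matQ_submatrix {R : Matrix (Fin N ⊕ Fin N) (Fin N ⊕ Fin N) ℂ} (k : Fin N)
    (hR : ∀ j x : Fin N, lam j = lam k → lam x ≠ lam k → R (.inl j) (.inr x) = 0) :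
    (R * matQ A B ι φ N M).conjTranspose.submatrix id
        (fun j : {j : Fin N // lam j = lam k} => Sum.inl j.1) =
      ((matC A B ι φ N M).transpose.submatrix id Subtype.val :
          Matrix (Fin M) {j : Fin N // lam j = lam k} ℂ) *
        (R.submatrix (fun j : {j : Fin N // lam j = lam k} => .inl j.1)
          fun j : {j : Fin N // lam j = lam k} => .inr j.1).conjTranspose := by
  ext i j
  rw [Matrix.mul_apply, Matrix.submatrix_apply, conjTranspose_mul_matQ_apply, id,
    ← Fintype.sum_subtype_add_sum_subtype (fun x : Fin N => lam x = lam k)]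
  have hoff : ∑ x : {x : Fin N // ¬ lam x = lam k},
      matC A B ι φ N M x i * star (R (.inl j.1) (.inr x)) = 0 :=
    Finset.sum_eq_zero fun x _ => by rw [hR j.1 x.1 j.2 x.2, star_zero, mul_zero]
  rw [hoff, add_zero]
  rfl

theorem JordanRank.card_le_rank (hδ : 0 < δ) (h : JordanRank A B ι φ lam δ N M) (k : Fin N) :
    Fintype.card {j : Fin N // lam j = lam k} ≤
      ((matC A B ι φ N M).transpose.submatrix id Subtype.val :
        Matrix (Fin M) {j : Fin N // lam j = lam k} ℂ).rank := by
  obtain ⟨R, J, hR, hJ, hdiag, hP, hS⟩ := h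
  have hRP : R * matP δ lam N = J * R := by
    rw [hP, ← mul_assoc, ← mul_assoc,
      Matrix.mul_nonsing_inv _ ((Matrix.isUnit_iff_isUnit_det R).mp hR), one_mul]
  refine (card_le_mult k).trans ?_
  rw [← (hS k).1, conjTranspose_mul_matQ_submatrix k fun j x hj hx =>
    (row_eq_zero hδ hJ hdiag hRP x (.inl j) fun h => hx (h.symm.trans hj)).2]
  exact Matrix.rank_mul_le_left _ _

theorem JordanRank.rowsIndep (hδ : 0 < δ) (h : JordanRank A B ι φ lam δ N M) :
    RowsIndep (fun j : Fin N => lam j)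
      (fun (j : Fin N) (i : Fin M) => inner ℝ (B (ι (φ i))) (φ j : H)) := by
  intro k ξ hsupp hξ
  have hinj := mulVec_injective_of_card_le_rank (h.card_le_rank hδ k)
  have hmulVec : ((matC A B ι φ N M).transpose.submatrix id Subtype.val).mulVec
      (fun j : {j : Fin N // lam j = lam k} => (ξ j.1 : ℂ)) = 0 := by
    funext i
    have hsum := hξ i
    have hoff : ∑ j : {j : Fin N // ¬ lam j = lam k},
        inner ℝ (B (ι (φ i))) (φ j.1 : H) * ξ j.1 = 0 :=
      Finset.sum_eq_zero fun j _ => by rw [hsupp j.1 j.2, mul_zero]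
    rw [← Fintype.sum_subtype_add_sum_subtype (fun j : Fin N => lam j = lam k), hoff,
      add_zero] at hsum
    simp only [Matrix.mulVec, dotProduct, Matrix.submatrix_apply, Matrix.transpose_apply, matC,
      Matrix.of_apply, id, Pi.zero_apply]
    exact_mod_cast hsum
  have hzero := hinj (hmulVec.trans (Matrix.mulVec_zero _).symm)
  funext j
  by_cases hj : lam j = lam k
  · simpa using congrFun hzero ⟨j, hj⟩
  · exact hsupp j hj

end Rank

/-! ### Convolution with the kernel -/

section Conv

variable {E : Type*} [NormedAddCommGroup E] [NormedSpace ℝ E] {δ : ℝ}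

/-- The convolution of `y` with the kernel. -/
noncomputable def conv (δ : ℝ) (y : ℝ → E) (t : ℝ) : E :=
  ∫ s in (0 : ℝ)..t, beta δ (t - s) • y s

theorem continuous_beta (δ : ℝ) : Continuous (beta δ) := by
  unfold beta
  fun_prop

theorem conv_congr {y z : ℝ → E} (h : ∀ t ≥ 0, y t = z t) {t : ℝ} (ht : 0 ≤ t) :
    conv δ y t = conv δ z t := by
  refine intervalIntegral.integral_congr fun s hs => ?_
  rw [uIcc_of_le ht] at hs
  simp only [h s hs.1]

theorem intervalIntegrable_conv (δ : ℝ) {y : ℝ → E} (hy : ContinuousOn y (Ici 0)) {t : ℝ}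
    (ht : 0 ≤ t) : IntervalIntegrable (fun s => beta δ (t - s) • y s) volume 0 t := by
  refine ContinuousOn.intervalIntegrable ?_
  rw [uIcc_of_le ht]
  exact ((continuous_beta δ).comp (continuous_const.sub continuous_id)).continuousOn.smul
    (hy.mono Icc_subset_Ici_self)

/-- The value `y (max s 0)` extends `y` continuously to the negative axis. -/
theorem conv_eq (δ : ℝ) (y : ℝ → E) {t : ℝ} (ht : 0 ≤ t) :
    conv δ y t = beta δ t • ∫ s in (0 : ℝ)..t, beta δ (-s) • y (max s 0) := by
  rw [conv, ← intervalIntegral.integral_smul]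
  refine intervalIntegral.integral_congr fun s hs => ?_
  rw [uIcc_of_le ht] at hs
  simp only [smul_smul, max_eq_left hs.1, beta, ← Real.exp_add]
  ring_nf

theorem inner_conv {H : Type*} [NormedAddCommGroup H] [InnerProductSpace ℝ H] [CompleteSpace H]
    {y : ℝ → H} (hy : ContinuousOn y (Ici 0)) (e : H) {t : ℝ} (ht : 0 ≤ t) :
    inner ℝ e (conv δ y t) = conv δ (fun s => inner ℝ e (y s)) t := by
  simpa [conv, inner_smul_right] using
    ((innerSL ℝ e).intervalIntegral_comp_comm (intervalIntegrable_conv δ hy ht)).symm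

section Complete

variable [CompleteSpace E] {y : ℝ → E}

theorem hasDerivAt_beta_smul_integral (δ : ℝ) (hy : ContinuousOn y (Ici 0)) (t : ℝ) :
    HasDerivAt (fun t => beta δ t • ∫ s in (0 : ℝ)..t, beta δ (-s) • y (max s 0))
      (beta δ t • (beta δ (-t) • y (max t 0)) +
        (-δ * beta δ t) • ∫ s in (0 : ℝ)..t, beta δ (-s) • y (max s 0)) t := by
  have hcont : Continuous fun s => beta δ (-s) • y (max s 0) :=
    ((continuous_beta δ).comp continuous_neg).smul
      (hy.comp_continuous (by fun_prop) fun s => le_max_right s 0)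
  exact (hasDerivAt_beta δ t).smul (hcont.integral_hasStrictDerivAt 0 t).hasDerivAt

theorem continuousOn_conv (δ : ℝ) (hy : ContinuousOn y (Ici 0)) :
    ContinuousOn (conv δ y) (Ici 0) :=
  (continuous_iff_continuousAt.mpr fun t =>
    (hasDerivAt_beta_smul_integral δ hy t).continuousAt).continuousOn.congr
      fun _ ht => conv_eq δ y ht

theorem hasDerivAt_conv (δ : ℝ) (hy : ContinuousOn y (Ici 0)) {t : ℝ} (ht : 0 < t) :
    HasDerivAt (conv δ y) (y t - δ • conv δ y t) t := by
  have heq : conv δ y =ᶠ[𝓝 t]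
      fun t => beta δ t • ∫ s in (0 : ℝ)..t, beta δ (-s) • y (max s 0) := by
    filter_upwards [lt_mem_nhds ht] with s hs using conv_eq δ y hs.le
  have hbeta : beta δ t * beta δ (-t) = 1 := by simp [beta, ← Real.exp_add]
  refine ((hasDerivAt_beta_smul_integral δ hy t).congr_of_eventuallyEq heq).congr_deriv ?_
  rw [conv_eq δ y ht.le, max_eq_left ht.le, smul_smul, hbeta]
  module

end Complete

theorem IsMode.snd_eq_conv {l x : ℝ} {h y z : ℝ → ℝ} (hδ : 0 < δ) (hm : IsMode δ l x h y z)
    {t : ℝ} (ht : 0 ≤ t) : z t = conv δ y t := by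
  have hbound := abs_le_of_hasDerivAt_neg_mul_add (w := fun t => z t - conv δ y t)
    (g := fun _ => 0) hδ le_rfl (hm.continuousOn_snd.sub (continuousOn_conv δ hm.continuousOn_fst))
    (fun s hs => ((hm.hasDerivAt_snd s hs).fun_sub
      (hasDerivAt_conv δ hm.continuousOn_fst hs)).congr_deriv (by rw [smul_eq_mul]; ring))
    (by simp) ht le_rfl
  have hzero : z 0 - conv δ y 0 = 0 := by simp [hm.snd_zero, conv]
  rw [hzero, abs_zero, mul_zero, zero_div, add_zero] at hbound
  exact sub_eq_zero.mp (abs_nonpos_iff.mp hbound)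

end Conv

/-! ### The equation in `H` -/

section Equation

theorem continuousOn_Ici_of_Icc {E : Type*} [TopologicalSpace E] {f : ℝ → E}
    (hf : ∀ T > 0, ContinuousOn f (Icc 0 T)) : ContinuousOn f (Ici 0) := by
  intro t ht
  rw [mem_Ici] at ht
  refine (hf (t + 1) (by linarith) t ⟨ht, by linarith⟩).mono_of_mem_nhdsWithin ?_
  rw [← Ici_inter_Iic]
  exact inter_mem self_mem_nhdsWithin (mem_nhdsWithin_of_mem_nhds (Iic_mem_nhds (by linarith)))

section ContDiffOn

variable {E : Type*} [NormedAddCommGroup E] [NormedSpace ℝ E] {f f' : ℝ → E}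

theorem contDiffOn_one_of_hasDerivWithinAt {s : Set ℝ} (hs : UniqueDiffOn ℝ s)
    (hf : ∀ t ∈ s, HasDerivWithinAt f (f' t) s t) (hf' : ContinuousOn f' s) :
    ContDiffOn ℝ 1 f s :=
  (contDiffOn_one_iff_derivWithin hs).mpr ⟨fun t ht => (hf t ht).differentiableWithinAt,
    hf'.congr fun t ht => (hf t ht).derivWithin (hs t ht)⟩

theorem hasDerivWithinAt_Ici_of_hasDerivAt (hf : ContinuousOn f (Ici 0))
    (hderiv : ∀ t > 0, HasDerivAt f (f' t) t) (hf' : ContinuousOn f' (Ici 0)) {t : ℝ}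
    (ht : 0 ≤ t) : HasDerivWithinAt f (f' t) (Ici 0) t := by
  rcases ht.eq_or_lt with rfl | ht
  · refine hasDerivWithinAt_Ici_of_tendsto_deriv (s := Ioi 0)
      (fun t ht => (hderiv t ht).differentiableAt.differentiableWithinAt)
      ((hf 0 self_mem_Ici).mono Ioi_subset_Ici_self) self_mem_nhdsWithin ?_
    refine Tendsto.congr' ?_ ((hf' 0 self_mem_Ici).mono Ioi_subset_Ici_self)
    filter_upwards [self_mem_nhdsWithin] with t ht using (hderiv t ht).deriv.symm
  · exact (hderiv t ht).hasDerivWithinAt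

end ContDiffOn

variable {H : Type*} [NormedAddCommGroup H] [InnerProductSpace ℝ H]
  {A : H →ₗ.[ℝ] H} {φ : ℕ → A.domain} {lam : ℕ → ℝ} {δ : ℝ} {F : ℝ → H} {x : H}

theorem IsSolution.congr {G : ℝ → H} {y : ℝ → H} (hFG : ∀ t ≥ 0, F t = G t)
    (h : IsSolution A δ F x y) : IsSolution A δ G x y := by
  obtain ⟨hcont, hzero, hdiff, heq⟩ := h
  refine ⟨hcont, hzero, hdiff, fun t ht => ?_⟩
  rw [← hFG t ht.le]
  exact heq t ht

theorem IsClassicalSolution.congr {G : ℝ → H} {y : ℝ → H} (hFG : ∀ t ≥ 0, F t = G t)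
    (h : IsClassicalSolution A δ F x y) : IsClassicalSolution A δ G x y := by
  obtain ⟨hzero, hdiff, z, hz, heq⟩ := h
  refine ⟨hzero, hdiff, z, hz, fun t ht => ?_⟩
  rw [← hFG t ht]
  exact heq t ht

section Uniqueness

variable [CompleteSpace H]

theorem IsSolution.isMode (hdense : Dense (A.domain : Set H)) (hself : IsSelfAdjoint A)
    (hφ : IsEigenbasis A φ lam) {y : ℝ → H} (h : IsSolution A δ F x y) (n : ℕ) :
    IsMode δ (lam n) (inner ℝ (φ n : H) x) (fun t => inner ℝ (φ n : H) (F t))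
      (fun t => inner ℝ (φ n : H) (y t)) (conv δ fun t => inner ℝ (φ n : H) (y t)) := by
  obtain ⟨hy, hzero, hdiff, heq⟩ := h
  have hcoeff : ContinuousOn (fun t => inner ℝ (φ n : H) (y t)) (Ici 0) :=
    continuousOn_const.inner hy
  refine ⟨hcoeff, continuousOn_conv δ hcoeff, by rw [hzero], by simp [conv], fun t ht => ?_,
    fun t ht => hasDerivAt_conv δ hcoeff ht⟩
  have hderiv : HasDerivAt y (deriv y t) t :=
    ((hdiff.differentiableOn one_ne_zero).differentiableAt (Ioi_mem_nhds ht)).hasDerivAt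
  refine ((innerSL ℝ (φ n : H)).hasFDerivAt.comp_hasDerivAt t hderiv).congr_deriv ?_
  obtain ⟨a, c, ha, hc, hac⟩ := heq t ht
  rw [innerSL_apply_apply, ← hac, inner_add_right, inner_add_right,
    hφ.inner_apply hdense hself, hφ.inner_apply hdense hself, ha, hc, ← inner_conv hy _ ht.le, conv]
  ring

theorem IsSolution.eqOn (hdense : Dense (A.domain : Set H)) (hself : IsSelfAdjoint A)
    (hφ : IsEigenbasis A φ lam) (hlam : ∀ n, 0 < lam n) (hδ : 0 < δ) {y z : ℝ → H}
    (hy : IsSolution A δ F x y) (hz : IsSolution A δ F x z) : EqOn y z (Ici 0) := by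
  obtain ⟨b, hb⟩ := hφ.exists_hilbertBasis
  refine fun t ht => ext_inner_basis b fun n => ?_
  rw [hb]
  exact IsMode.fst_eq hδ (hlam n) (hy.isMode hdense hself hφ n) (hz.isMode hdense hself hφ n) ht

end Uniqueness

/-- The coefficients `Y n t`, in the basis `b`, of a candidate solution with initial value `x` and
forcing `F`, together with the coefficients `Z n t` of its convolution with the kernel. The
coefficients of the forcing are dominated, uniformly in time, by a square summable sequence `G`. -/
structure IsModalSystem (b : HilbertBasis ℕ ℝ H) (δ : ℝ) (lam : ℕ → ℝ) (F : ℝ → H) (x : H)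
    (G : ℕ → ℝ) (Y Z : ℕ → ℝ → ℝ) : Prop where
  rate_pos : 0 < δ
  eigenvalue_pos : ∀ n, 0 < lam n
  continuousOn_forcing : ContinuousOn F (Ici 0)
  summable_sq : Summable fun n => G n ^ 2
  abs_forcing_le : ∀ n, ∀ t ≥ 0, |inner ℝ (b n) (F t)| ≤ G n
  isMode : ∀ n, IsMode δ (lam n) (inner ℝ (b n) x) (fun t => inner ℝ (b n) (F t)) (Y n) (Z n)

/-- The bound of the coefficients `Y n` and `lam n * Z n` on `[0, T]`. -/
noncomputable def modalBound (b : HilbertBasis ℕ ℝ H) (δ : ℝ) (x : H) (G : ℕ → ℝ) (T : ℝ) (n : ℕ) :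
    ℝ :=
  modeConst δ T * (|inner ℝ (b n) x| + G n)

/-- The derivatives of the coefficients `Y n`. -/
noncomputable def modalDeriv (b : HilbertBasis ℕ ℝ H) (lam : ℕ → ℝ) (F : ℝ → H) (Y Z : ℕ → ℝ → ℝ)
    (t : ℝ) (n : ℕ) : ℝ :=
  -(lam n * (Y n t + Z n t)) + inner ℝ (b n) (F t)

/-- `r` dominates `lam n * exp (-lam n * t) * |x_n|` for all times `t` in `S`. Where this bound is
square summable, the terms of the equation converge in `H`: for an initial value in the domain this
holds up to `t = 0`, for an arbitrary one away from `t = 0`. -/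
def SmoothingBound (b : HilbertBasis ℕ ℝ H) (lam : ℕ → ℝ) (x : H) (S : Set ℝ) (r : ℕ → ℝ) :
    Prop :=
  (Summable fun n => r n ^ 2) ∧
    ∀ t ∈ S, ∀ n, lam n * Real.exp (-lam n * t) * |inner ℝ (b n) x| ≤ r n

variable {b : HilbertBasis ℕ ℝ H} {G : ℕ → ℝ} {Y Z : ℕ → ℝ → ℝ} {S : Set ℝ} {r : ℕ → ℝ}

theorem SmoothingBound.mono {S' : Set ℝ} (hr : SmoothingBound b lam x S r) (hS : S' ⊆ S) :
    SmoothingBound b lam x S' r :=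
  ⟨hr.1, fun t ht => hr.2 t (hS ht)⟩

theorem smoothingBound_Ici {a : ℝ} (ha : 0 < a) :
    SmoothingBound b lam x (Ici a) fun n => a⁻¹ * |inner ℝ (b n) x| :=
  ⟨summable_sq_const_mul _ (summable_sq_abs (hasSum_sq_inner b x).summable), fun _ ht n =>
    mul_le_mul_of_nonneg_right ((mul_exp_neg_mul_le_inv (lam n) (ha.trans_le ht)).trans
      (inv_anti₀ ha ht)) (abs_nonneg _)⟩

theorem smoothingBound_of_mem_domain [CompleteSpace H] (hdense : Dense (A.domain : Set H))
    (hself : IsSelfAdjoint A) (hφ : IsEigenbasis A φ lam) (hlam : ∀ n, 0 < lam n)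
    (hb : ∀ n, b n = φ n) (hx : x ∈ A.domain) :
    SmoothingBound b lam x (Ici 0) fun n => lam n * |inner ℝ (b n) x| := by
  refine ⟨(hasSum_sq_inner b (A ⟨x, hx⟩)).summable.congr fun n => ?_, fun t ht n => ?_⟩
  · simp only [hb, hφ.inner_apply hdense hself, mul_pow, sq_abs]
  · refine mul_le_mul_of_nonneg_right (mul_le_of_le_one_right (hlam n).le ?_) (abs_nonneg _)
    exact Real.exp_le_one_iff.mpr (mul_nonpos_of_nonpos_of_nonneg (neg_nonpos.mpr (hlam n).le) ht)

namespace IsModalSystem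

theorem summable_sq_modalBound (hm : IsModalSystem b δ lam F x G Y Z) (T : ℝ) :
    Summable fun n => modalBound b δ x G T n ^ 2 :=
  summable_sq_const_mul _
    (summable_sq_add (summable_sq_abs (hasSum_sq_inner b x).summable) hm.summable_sq)

theorem nonneg (hm : IsModalSystem b δ lam F x G Y Z) (n : ℕ) : 0 ≤ G n :=
  (abs_nonneg _).trans (hm.abs_forcing_le n 0 le_rfl)

theorem abs_fst_le (hm : IsModalSystem b δ lam F x G Y Z) {t T : ℝ} (ht : t ∈ Icc 0 T) (n : ℕ) :
    |Y n t| ≤ modalBound b δ x G T n :=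
  (hm.isMode n).abs_fst_le hm.rate_pos (hm.eigenvalue_pos n) (hm.nonneg n)
    (fun s hs _ => hm.abs_forcing_le n s hs.le) ht.1 ht.2

theorem mul_abs_snd_le (hm : IsModalSystem b δ lam F x G Y Z) {t T : ℝ} (ht : t ∈ Icc 0 T)
    (n : ℕ) : lam n * |Z n t| ≤ modalBound b δ x G T n :=
  (hm.isMode n).mul_abs_snd_le hm.rate_pos (hm.eigenvalue_pos n) (hm.nonneg n)
    (fun s hs _ => hm.abs_forcing_le n s hs.le) ht.1 ht.2

theorem mul_abs_add_le (hm : IsModalSystem b δ lam F x G Y Z) (hr : SmoothingBound b lam x S r)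
    {t T : ℝ} (ht : t ∈ Icc 0 T) (htS : t ∈ S) (n : ℕ) :
    lam n * |Y n t + Z n t| ≤ modalBound b δ x G T n + r n :=
  ((hm.isMode n).mul_abs_add_le hm.rate_pos (hm.eigenvalue_pos n) (hm.nonneg n)
    (fun s hs _ => hm.abs_forcing_le n s hs.le) ht.1 ht.2).trans
      (add_le_add_right (hr.2 t htS n) _)

theorem mul_abs_fst_le (hm : IsModalSystem b δ lam F x G Y Z) (hr : SmoothingBound b lam x S r)
    {t T : ℝ} (ht : t ∈ Icc 0 T) (htS : t ∈ S) (n : ℕ) :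
    |lam n * Y n t| ≤ 2 * modalBound b δ x G T n + r n := by
  have htri : |Y n t| ≤ |Y n t + Z n t| + |Z n t| := by simpa using abs_sub (Y n t + Z n t) (Z n t)
  rw [abs_mul, abs_of_pos (hm.eigenvalue_pos n)]
  linarith [mul_le_mul_of_nonneg_left htri (hm.eigenvalue_pos n).le,
    hm.mul_abs_add_le hr ht htS n, hm.mul_abs_snd_le ht n]

theorem abs_modalDeriv_le (hm : IsModalSystem b δ lam F x G Y Z)
    (hr : SmoothingBound b lam x S r) {t T : ℝ} (ht : t ∈ Icc 0 T) (htS : t ∈ S) (n : ℕ) :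
    |modalDeriv b lam F Y Z t n| ≤ modalBound b δ x G T n + r n + G n := by
  refine (abs_add_le _ _).trans (add_le_add ?_ (hm.abs_forcing_le n t ht.1))
  rw [abs_neg, abs_mul, abs_of_pos (hm.eigenvalue_pos n)]
  exact hm.mul_abs_add_le hr ht htS n

theorem summable_sq_modalDeriv_bound (hm : IsModalSystem b δ lam F x G Y Z)
    (hr : SmoothingBound b lam x S r) (T : ℝ) :
    Summable fun n => (modalBound b δ x G T n + r n + G n) ^ 2 :=
  summable_sq_add (summable_sq_add (hm.summable_sq_modalBound T) hr.1) hm.summable_sq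

theorem continuousOn_modalDeriv (hm : IsModalSystem b δ lam F x G Y Z) (n : ℕ) :
    ContinuousOn (fun t => modalDeriv b lam F Y Z t n) (Ici 0) :=
  (((hm.isMode n).continuousOn_fst.add (hm.isMode n).continuousOn_snd).const_smul (lam n)).neg.add
    (continuousOn_const.inner hm.continuousOn_forcing)

theorem synth_zero (hm : IsModalSystem b δ lam F x G Y Z) : (synth b fun n => Y n 0) = x := by
  have hzero : (fun n => Y n 0) = fun n => inner ℝ (b n) x := funext fun n => (hm.isMode n).fst_zero
  rw [hzero]
  exact ext_inner_basis b fun n => inner_synth b (hasSum_sq_inner b x).summable n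

theorem inner_synth_fst (hm : IsModalSystem b δ lam F x G Y Z) {t : ℝ} (ht : 0 ≤ t) (n : ℕ) :
    inner ℝ (b n) (synth b fun n => Y n t) = Y n t :=
  inner_synth b (summable_sq_of_abs_le (hm.summable_sq_modalBound t)
    (hm.abs_fst_le (right_mem_Icc.mpr ht))) n

theorem continuousOn_synth_fst (hm : IsModalSystem b δ lam F x G Y Z) :
    ContinuousOn (fun t => synth b fun n => Y n t) (Ici 0) :=
  continuousOn_Ici_of_Icc fun T _ => continuousOn_synth b (hm.summable_sq_modalBound T)
    (fun _ ht => hm.abs_fst_le ht)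
    fun n => (hm.isMode n).continuousOn_fst.mono Icc_subset_Ici_self

theorem continuousOn_synth_modalDeriv (hm : IsModalSystem b δ lam F x G Y Z) {T : ℝ}
    (hS : S ⊆ Icc 0 T) (hr : SmoothingBound b lam x S r) :
    ContinuousOn (fun t => synth b (modalDeriv b lam F Y Z t)) S :=
  continuousOn_synth b (hm.summable_sq_modalDeriv_bound hr T)
    (fun _ ht => hm.abs_modalDeriv_le hr (hS ht) ht)
    fun n => (hm.continuousOn_modalDeriv n).mono (hS.trans Icc_subset_Ici_self)

theorem hasDerivAt_synth_fst (hm : IsModalSystem b δ lam F x G Y Z) {t : ℝ} (ht : 0 < t) :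
    HasDerivAt (fun t => synth b fun n => Y n t) (synth b (modalDeriv b lam F Y Z t)) t := by
  have hr : SmoothingBound b lam x (Ici (t / 2)) _ := smoothingBound_Ici (half_pos ht)
  have hpos : ∀ s ∈ Ioo (t / 2) (t + 1), 0 < s := fun s hs => (half_pos ht).trans hs.1
  refine hasDerivAt_synth b isOpen_Ioo (hm.summable_sq_modalBound (t + 1))
    (fun s hs => hm.abs_fst_le ⟨(hpos s hs).le, hs.2.le⟩)
    (hm.summable_sq_modalDeriv_bound hr (t + 1))
    (fun s hs => hm.abs_modalDeriv_le hr ⟨(hpos s hs).le, hs.2.le⟩ hs.1.le)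
    (fun n s hs => ((hm.isMode n).hasDerivAt_fst s (hpos s hs)).congr_deriv ?_)
    ⟨by linarith, by linarith⟩
  rw [modalDeriv]
  ring

theorem contDiffOn_synth_fst (hm : IsModalSystem b δ lam F x G Y Z) :
    ContDiffOn ℝ 1 (fun t => synth b fun n => Y n t) (Ioi 0) := by
  refine contDiffOn_one_of_hasDerivWithinAt isOpen_Ioi.uniqueDiffOn
    (fun t ht => (hm.hasDerivAt_synth_fst ht).hasDerivWithinAt) fun t ht => ?_
  have hIcc : Icc (t / 2) (t + 1) ⊆ Icc 0 (t + 1) := Icc_subset_Icc_left (half_pos ht).le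
  have hcont := hm.continuousOn_synth_modalDeriv hIcc
    ((smoothingBound_Ici (half_pos ht)).mono Icc_subset_Ici_self)
  exact (hcont.continuousAt (Icc_mem_nhds (half_lt_self ht) (lt_add_one t))).continuousWithinAt

theorem summable_sq_mul_fst (hm : IsModalSystem b δ lam F x G Y Z)
    (hr : SmoothingBound b lam x S r) {t : ℝ} (ht : 0 ≤ t) (htS : t ∈ S) :
    Summable fun n => (lam n * Y n t) ^ 2 :=
  summable_sq_of_abs_le
    (summable_sq_add (summable_sq_const_mul 2 (hm.summable_sq_modalBound t)) hr.1)
    (hm.mul_abs_fst_le hr (right_mem_Icc.mpr ht) htS)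

theorem summable_sq_mul_snd (hm : IsModalSystem b δ lam F x G Y Z) {t : ℝ} (ht : 0 ≤ t) :
    Summable fun n => (lam n * Z n t) ^ 2 := by
  refine summable_sq_of_abs_le (hm.summable_sq_modalBound t) fun n => ?_
  rw [abs_mul, abs_of_pos (hm.eigenvalue_pos n)]
  exact hm.mul_abs_snd_le (right_mem_Icc.mpr ht) n

theorem continuousOn_synth_mul_fst (hm : IsModalSystem b δ lam F x G Y Z) {T : ℝ}
    (hS : S ⊆ Icc 0 T) (hr : SmoothingBound b lam x S r) :
    ContinuousOn (fun t => synth b fun n => lam n * Y n t) S :=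
  continuousOn_synth b
    (summable_sq_add (summable_sq_const_mul 2 (hm.summable_sq_modalBound T)) hr.1)
    (fun _ ht => hm.mul_abs_fst_le hr (hS ht) ht)
    fun n => continuousOn_const.mul
      ((hm.isMode n).continuousOn_fst.mono (hS.trans Icc_subset_Ici_self))

theorem synth_modalDeriv_add (hm : IsModalSystem b δ lam F x G Y Z)
    (hr : SmoothingBound b lam x S r) {t : ℝ} (ht : 0 ≤ t) (htS : t ∈ S) :
    synth b (modalDeriv b lam F Y Z t) + (synth b fun n => lam n * Y n t)
      + (synth b fun n => lam n * Z n t) = F t := by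
  refine ext_inner_basis b fun n => ?_
  rw [inner_add_right, inner_add_right, inner_synth b (hm.summable_sq_mul_fst hr ht htS),
    inner_synth b (hm.summable_sq_mul_snd ht), inner_synth b (summable_sq_of_abs_le
      (hm.summable_sq_modalDeriv_bound hr t)
      (hm.abs_modalDeriv_le hr (right_mem_Icc.mpr ht) htS)), modalDeriv]
  ring

theorem synth_mem_graph (hm : IsModalSystem b δ lam F x G Y Z) (hclosed : A.IsClosed)
    (hφ : IsEigenbasis A φ lam) (hb : ∀ n, b n = φ n) (hr : SmoothingBound b lam x S r) {t : ℝ}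
    (ht : 0 ≤ t) (htS : t ∈ S) :
    (synth b fun n => Y n t, synth b fun n => lam n * Y n t) ∈ A.graph := by
  simpa only [hm.inner_synth_fst ht] using hφ.mem_graph_synth hclosed hb
    (x := synth b fun n => Y n t)
    (by simpa only [hm.inner_synth_fst ht] using hm.summable_sq_mul_fst hr ht htS)

section Complete

variable [CompleteSpace H]

theorem inner_conv_synth (hm : IsModalSystem b δ lam F x G Y Z) {t : ℝ} (ht : 0 ≤ t) (n : ℕ) :
    inner ℝ (b n) (conv δ (fun t => synth b fun n => Y n t) t) = Z n t := by
  rw [inner_conv hm.continuousOn_synth_fst _ ht, (hm.isMode n).snd_eq_conv hm.rate_pos ht]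
  exact conv_congr (fun s hs => hm.inner_synth_fst hs n) ht

theorem conv_mem_graph (hm : IsModalSystem b δ lam F x G Y Z) (hclosed : A.IsClosed)
    (hφ : IsEigenbasis A φ lam) (hb : ∀ n, b n = φ n) {t : ℝ} (ht : 0 ≤ t) :
    (conv δ (fun t => synth b fun n => Y n t) t, synth b fun n => lam n * Z n t) ∈ A.graph := by
  simpa only [hm.inner_conv_synth ht] using hφ.mem_graph_synth hclosed hb
    (x := conv δ (fun t => synth b fun n => Y n t) t)
    (by simpa only [hm.inner_conv_synth ht] using hm.summable_sq_mul_snd ht)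

theorem conv_synth_mul_fst (hm : IsModalSystem b δ lam F x G Y Z)
    (hr : SmoothingBound b lam x (Ici 0) r) {t : ℝ} (ht : 0 ≤ t) :
    conv δ (fun t => synth b fun n => lam n * Y n t) t = synth b fun n => lam n * Z n t := by
  have hcont : ContinuousOn (fun t => synth b fun n => lam n * Y n t) (Ici 0) :=
    continuousOn_Ici_of_Icc fun T _ =>
      hm.continuousOn_synth_mul_fst subset_rfl (hr.mono Icc_subset_Ici_self)
  refine ext_inner_basis b fun n => ?_
  rw [inner_conv hcont _ ht, inner_synth b (hm.summable_sq_mul_snd ht),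
    (hm.isMode n).snd_eq_conv hm.rate_pos ht, conv, conv, ← intervalIntegral.integral_const_mul]
  refine intervalIntegral.integral_congr fun s hs => ?_
  rw [uIcc_of_le ht] at hs
  simp only [inner_synth b (hm.summable_sq_mul_fst hr hs.1 hs.1), smul_eq_mul]
  ring

theorem isSolution (hm : IsModalSystem b δ lam F x G Y Z) (hclosed : A.IsClosed)
    (hφ : IsEigenbasis A φ lam) (hb : ∀ n, b n = φ n) :
    IsSolution A δ F x fun t => synth b fun n => Y n t := by
  refine ⟨hm.continuousOn_synth_fst, hm.synth_zero, hm.contDiffOn_synth_fst, fun t ht => ?_⟩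
  have hr : SmoothingBound b lam x (Ici t) _ := smoothingBound_Ici ht
  obtain ⟨a, ha, ha'⟩ := (LinearPMap.mem_graph_iff A).mp
    (hm.synth_mem_graph hclosed hφ hb hr ht.le self_mem_Ici)
  obtain ⟨c, hc, hc'⟩ := (LinearPMap.mem_graph_iff A).mp (hm.conv_mem_graph hclosed hφ hb ht.le)
  refine ⟨a, c, ha, hc, ?_⟩
  rw [(hm.hasDerivAt_synth_fst ht).deriv, ha', hc']
  exact hm.synth_modalDeriv_add hr ht.le self_mem_Ici

theorem isClassicalSolution (hm : IsModalSystem b δ lam F x G Y Z) (hclosed : A.IsClosed)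
    (hφ : IsEigenbasis A φ lam) (hb : ∀ n, b n = φ n) (hr : SmoothingBound b lam x (Ici 0) r) :
    IsClassicalSolution A δ F x fun t => synth b fun n => Y n t := by
  have hrT : ∀ T, SmoothingBound b lam x (Icc 0 T) r := fun T => hr.mono Icc_subset_Ici_self
  have hderiv_cont : ContinuousOn (fun t => synth b (modalDeriv b lam F Y Z t)) (Ici 0) :=
    continuousOn_Ici_of_Icc fun T _ => hm.continuousOn_synth_modalDeriv subset_rfl (hrT T)
  have hderiv : ∀ t ∈ Ici (0 : ℝ), HasDerivWithinAt (fun t => synth b fun n => Y n t)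
      (synth b (modalDeriv b lam F Y Z t)) (Ici 0) t := fun t ht =>
    hasDerivWithinAt_Ici_of_hasDerivAt hm.continuousOn_synth_fst
      (fun _ => hm.hasDerivAt_synth_fst) hderiv_cont ht
  refine ⟨hm.synth_zero,
    contDiffOn_one_of_hasDerivWithinAt (uniqueDiffOn_Ici 0) hderiv hderiv_cont,
    fun t => synth b fun n => lam n * Y n t,
    continuousOn_Ici_of_Icc fun T _ => hm.continuousOn_synth_mul_fst subset_rfl (hrT T),
    fun t ht => ⟨hm.synth_mem_graph hclosed hφ hb hr ht ht, ?_⟩⟩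
  rw [(hderiv t ht).derivWithin (uniqueDiffOn_Ici 0 t ht), ← hm.synth_modalDeriv_add hr ht ht,
    ← hm.conv_synth_mul_fst hr ht, conv]

end Complete

end IsModalSystem

end Equation

/-! ### Stabilization -/

section Stabilization

section Forcing

variable {H U : Type*} [NormedAddCommGroup H] [InnerProductSpace ℝ H]
  [NormedAddCommGroup U] [InnerProductSpace ℝ U]
  {A : H →ₗ.[ℝ] H} {B : U →L[ℝ] H} {δ : ℝ} {f : ℝ → H} {fe : H} {ye : A.domain}

theorem exists_absorbs (hf : ∀ t ≥ 0, f t ∈ range B) (hfe : fe ∈ range B) (δ : ℝ) (u : ℝ → U) :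
    ∃ ut, Absorbs B δ f fe u ut := by
  obtain ⟨fte, hfte⟩ := hfe
  choose! ft hft using hf
  exact ⟨fun t => u t - ft t + (1 - Real.exp (-δ * t) / (1 + δ)) • fte, ft, fte, hft, hfte,
    fun t _ => by module⟩

theorem Absorbs.translatedRHS_eq (hδ : 0 < δ) (hye : (1 + 1 / δ) • A ye = fe) {u ut : ℝ → U}
    (h : Absorbs B δ f fe u ut) {t : ℝ} (ht : 0 ≤ t) :
    translatedRHS A B δ f fe ye ut t = B (u t) := by
  obtain ⟨ft, fte, hft, hfte, hu⟩ := h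
  rw [hu t ht, map_sub, map_add, map_smul, hft t ht, hfte, translatedRHS, ← hye, smul_smul]
  have hδ_add : 1 + δ ≠ 0 := by positivity
  match_scalars <;> field_simp
  ring

theorem Stabilizes.mono {γ C C' : ℝ} (hC : C ≤ C') {y₀ : H} {u : ℝ → U}
    (h : Stabilizes A B δ γ C f fe ye y₀ u) : Stabilizes A B δ γ C' f fe ye y₀ u := by
  refine ⟨h.1, fun ut hut => ?_⟩
  obtain ⟨y, hsol, hunique, hclassical, hdecay⟩ := h.2 ut hut
  refine ⟨y, hsol, hunique, hclassical, fun t ht => (hdecay t ht).trans ?_⟩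
  gcongr

end Forcing

section Decay

variable {δ γ : ℝ}

theorem IsMode.sq_fst_le_exp_of_vanish {l x G T : ℝ} {h y z : ℝ → ℝ} (hm : IsMode δ l x h y z)
    (hδ : 0 < δ) (hl : 0 < l) (hγ : 0 ≤ γ) (hG : 0 ≤ G) (hh : ∀ t > 0, |h t| ≤ G)
    (hvanish : ∀ t ≥ T, y t = 0) {t : ℝ} (ht : 0 ≤ t) :
    y t ^ 2 ≤ 2 * modeConst δ T ^ 2 * Real.exp (2 * γ * T) * (x ^ 2 + G ^ 2)
      * Real.exp (-(2 * γ) * t) := by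
  rcases le_or_gt T t with hTt | htT
  · rw [hvanish t hTt, zero_pow two_ne_zero]
    positivity
  have hexp : 1 ≤ Real.exp (2 * γ * T) * Real.exp (-(2 * γ) * t) := by
    rw [← Real.exp_add]
    exact Real.one_le_exp (by nlinarith)
  have hbound := sq_le_sq_of_abs_le (hm.abs_fst_le hδ hl hG (fun s hs _ => hh s hs) ht htT.le)
  calc y t ^ 2 ≤ (modeConst δ T * (|x| + G)) ^ 2 := hbound
    _ ≤ modeConst δ T ^ 2 * (2 * (x ^ 2 + G ^ 2)) := by
        rw [mul_pow, ← sq_abs x]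
        gcongr
        exact add_sq_le
    _ ≤ modeConst δ T ^ 2 * (2 * (x ^ 2 + G ^ 2))
          * (Real.exp (2 * γ * T) * Real.exp (-(2 * γ) * t)) :=
        le_mul_of_one_le_right (by positivity) hexp
    _ = _ := by ring

theorem exists_sq_fst_le_exp {lam : ℕ → ℝ} {N : ℕ} (hmono : Monotone lam) (hlam : ∀ n, 0 < lam n)
    (hδ : 0 < δ) (hγ : 0 ≤ γ) (hγδ : γ ≤ 1 + δ) (hsum : 0 < lam N + δ - 2 * γ)
    (hprod : 0 < lam N * (1 + δ - γ) + γ ^ 2 - γ * δ) (T : ℝ) :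
    ∃ K ≥ 0, ∀ (n : ℕ) (x G : ℝ) (h y z : ℝ → ℝ), IsMode δ (lam n) x h y z → 0 ≤ G →
      (∀ t > 0, |h t| ≤ G * Real.exp (-(γ + 1) * t)) → (n < N → ∀ t ≥ T, y t = 0) →
      ∀ t ≥ 0, y t ^ 2 ≤ K * (x ^ 2 + G ^ 2) * Real.exp (-(2 * γ) * t) := by
  set a₀ := lam N + δ - 2 * γ
  set b₀ := lam N * (1 + δ - γ) + γ ^ 2 - γ * δ
  set K_stable := (2 + 2 * (δ - γ) ^ 2 / b₀) * (1 + 1 / (4 * a₀)) with hK_stable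
  set K_unstable := 2 * modeConst δ T ^ 2 * Real.exp (2 * γ * T)
  have hK_stable₀ : 0 ≤ K_stable := by positivity
  have hK_unstable₀ : 0 ≤ K_unstable := by positivity
  refine ⟨K_stable + K_unstable, by positivity, fun n x G h y z hm hG hh hvanish t ht => ?_⟩
  rcases le_or_gt N n with hn | hn
  · have hle := hmono hn
    have hle_mul := mul_le_mul_of_nonneg_right hle (sub_nonneg.mpr hγδ)
    have hdata : x ^ 2 + G ^ 2 / (4 * a₀) ≤ (1 + 1 / (4 * a₀)) * (x ^ 2 + G ^ 2) := by
      have hx : 0 ≤ 1 / (4 * a₀) * x ^ 2 := by positivity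
      rw [div_eq_mul_one_div, mul_comm (G ^ 2)]
      linarith [sq_nonneg G]
    calc y t ^ 2 ≤ (2 + 2 * (δ - γ) ^ 2 / b₀) * (x ^ 2 + G ^ 2 / (4 * a₀))
          * Real.exp (-(2 * γ) * t) :=
          hm.sq_fst_le_exp hsum hprod (by linarith) (by linarith) hh ht
      _ ≤ (2 + 2 * (δ - γ) ^ 2 / b₀) * ((1 + 1 / (4 * a₀)) * (x ^ 2 + G ^ 2))
          * Real.exp (-(2 * γ) * t) := by gcongr
      _ = K_stable * (x ^ 2 + G ^ 2) * Real.exp (-(2 * γ) * t) := by rw [hK_stable]; ring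
      _ ≤ (K_stable + K_unstable) * (x ^ 2 + G ^ 2) * Real.exp (-(2 * γ) * t) := by
          gcongr
          linarith
  · have hh_le : ∀ s > 0, |h s| ≤ G := fun s hs =>
      (hh s hs).trans (mul_le_of_le_one_right hG (Real.exp_le_one_iff.mpr (by nlinarith)))
    refine (hm.sq_fst_le_exp_of_vanish hδ (hlam n) hγ hG hh_le (hvanish hn) ht).trans ?_
    gcongr
    linarith

end Decay

variable {H U : Type*} [NormedAddCommGroup H] [InnerProductSpace ℝ H]
  [NormedAddCommGroup U] [InnerProductSpace ℝ U]
  {A : H →ₗ.[ℝ] H} {B : U →L[ℝ] H} {ι : A.domain →ₗ[ℝ] U} {φ : ℕ → A.domain} {lam : ℕ → ℝ}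
  {δ γ : ℝ} {b : HilbertBasis ℕ ℝ H}

theorem exists_norm_sq_synth_le_exp {N : ℕ} (hmono : Monotone lam) (hlam : ∀ n, 0 < lam n)
    (hδ : 0 < δ) (hγ : 0 ≤ γ) (hγδ : γ ≤ 1 + δ) (hsum : 0 < lam N + δ - 2 * γ)
    (hprod : 0 < lam N * (1 + δ - γ) + γ ^ 2 - γ * δ) (b : HilbertBasis ℕ ℝ H) (T : ℝ) :
    ∃ K ≥ 0, ∀ (F : ℝ → H) (x : H) (G : ℕ → ℝ) (Y Z : ℕ → ℝ → ℝ),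
      IsModalSystem b δ lam F x G Y Z →
      (∀ n, ∀ t > 0, |inner ℝ (b n) (F t)| ≤ G n * Real.exp (-(γ + 1) * t)) →
      (∀ n < N, ∀ t ≥ T, Y n t = 0) → ∀ t ≥ 0, ‖synth b fun n => Y n t‖ ^ 2 ≤
        K * (‖x‖ ^ 2 + ∑' n, G n ^ 2) * Real.exp (-(2 * γ) * t) := by
  obtain ⟨K, hK₀, hK⟩ := exists_sq_fst_le_exp hmono hlam hδ hγ hγδ hsum hprod T
  refine ⟨K, hK₀, fun F x G Y Z hm hF hvanish t ht => ?_⟩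
  refine hasSum_le (fun n => ?_) (hasSum_sq_inner b _)
    ((((hasSum_sq_inner b x).add hm.summable_sq.hasSum).mul_left K).mul_right _)
  rw [hm.inner_synth_fst ht]
  exact hK n _ _ _ _ _ (hm.isMode n) (hm.nonneg n) (hF n) (hvanish n) t ht

theorem exists_isModalSystem {F : ℝ → H} {x : H} {G : ℕ → ℝ} {T : ℝ} {N : ℕ} (hδ : 0 < δ)
    (hlam : ∀ n, 0 < lam n) (hF : Continuous F) (hG : Summable fun n => G n ^ 2)
    (hFG : ∀ n, ∀ t ≥ 0, |inner ℝ (b n) (F t)| ≤ G n) (hvanish : ∀ t ≥ T, F t = 0)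
    (hsteer : ∀ n < N, ∫ s in (0 : ℝ)..T,
      inner ℝ (b n) (F s) • backwardOrbit (modeGen δ (lam n)) (1, 0) s = -(inner ℝ (b n) x, 0)) :
    ∃ Y Z : ℕ → ℝ → ℝ, IsModalSystem b δ lam F x G Y Z ∧ ∀ n < N, ∀ t ≥ T, Y n t = 0 := by
  have hFn : ∀ n, Continuous fun t => inner ℝ (b n) (F t) := fun n => continuous_const.inner hF
  refine ⟨_, _, ⟨hδ, hlam, hF.continuousOn, hG, hFG, fun n => isMode_duhamel δ _ _ (hFn n)⟩,
    fun n hn t ht => ?_⟩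
  rw [duhamel_eq_zero (hFn n) (fun s hs => by rw [hvanish s hs, inner_zero_right])
    (hsteer n hn) ht, Prod.fst_zero]

theorem stabilizes_of_isModalSystem [CompleteSpace H] (hclosed : A.IsClosed)
    (hdense : Dense (A.domain : Set H)) (hself : IsSelfAdjoint A) (hφ : IsEigenbasis A φ lam)
    (hb : ∀ n, b n = φ n) {f : ℝ → H} {fe : H} {ye : A.domain} (hf : ∀ t ≥ 0, f t ∈ range B)
    (hfe : fe ∈ range B) (hye : (1 + 1 / δ) • A ye = fe) {y₀ : H} {u : ℝ → U} {G : ℕ → ℝ}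
    {Y Z : ℕ → ℝ → ℝ} (hm : IsModalSystem b δ lam (fun t => B (u t)) (y₀ - ye) G Y Z) {C : ℝ}
    (hdecay : ∀ t ≥ 0, ‖synth b fun n => Y n t‖ ≤ C * Real.exp (-γ * t) * ‖y₀ - ye‖) :
    Stabilizes A B δ γ C f fe ye y₀ u := by
  refine ⟨exists_absorbs hf hfe δ u, fun ut hut => ?_⟩
  have hrhs : ∀ t ≥ 0, translatedRHS A B δ f fe ye ut t = B (u t) := fun _ =>
    hut.translatedRHS_eq hm.rate_pos hye
  have hsol := hm.isSolution hclosed hφ hb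
  refine ⟨fun t => synth b fun n => Y n t, hsol.congr fun t ht => (hrhs t ht).symm,
    fun z hz => (hz.congr hrhs).eqOn hdense hself hφ hm.eigenvalue_pos hm.rate_pos hsol,
    fun hy₀ => ?_, hdecay⟩
  have hsmooth := smoothingBound_of_mem_domain hdense hself hφ hm.eigenvalue_pos hb
    (A.domain.sub_mem hy₀ ye.2)
  exact (hm.isClassicalSolution hclosed hφ hb hsmooth).congr fun t ht => (hrhs t ht).symm

section FiniteControl

variable {M : ℕ} {v : Fin M → ℝ → ℝ}

/-- The sum `∑ |(B φ_i, φ_n)|` over the controls: the strength with which they act on the `n`-th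
mode. -/
noncomputable def controlWeight (B : U →L[ℝ] H) (ι : A.domain →ₗ[ℝ] U) (φ : ℕ → A.domain)
    (M n : ℕ) : ℝ :=
  ∑ i : Fin M, |inner ℝ (B (ι (φ i))) (φ n : H)|

theorem summable_sq_controlWeight (hb : ∀ n, b n = φ n) :
    Summable fun n => controlWeight B ι φ M n ^ 2 := by
  refine summable_sq_sum _ fun i => summable_sq_abs ?_
  refine (hasSum_sq_inner b (B (ι (φ i)))).summable.congr fun n => ?_
  rw [hb, real_inner_comm]

theorem continuous_finiteControl (hv : ∀ i, Continuous (v i)) :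
    Continuous (finiteControl ι φ v) :=
  continuous_finsetSum _ fun i _ => (hv i).smul continuous_const

theorem inner_map_finiteControl (n : ℕ) (t : ℝ) :
    inner ℝ (φ n : H) (B (finiteControl ι φ v t)) =
      ∑ i : Fin M, inner ℝ (B (ι (φ i))) (φ n : H) * v i t := by
  simp only [finiteControl, map_sum, map_smul, inner_sum, inner_smul_right]
  exact Finset.sum_congr rfl fun i _ => by rw [real_inner_comm, mul_comm]

theorem abs_inner_map_finiteControl_le {t R : ℝ} (hv : ∀ i, |v i t| ≤ R) (n : ℕ) :
    |inner ℝ (φ n : H) (B (finiteControl ι φ v t))| ≤ controlWeight B ι φ M n * R := by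
  rw [inner_map_finiteControl, controlWeight, Finset.sum_mul]
  refine (Finset.abs_sum_le_sum_abs _ _).trans (Finset.sum_le_sum fun i _ => ?_)
  rw [abs_mul]
  exact mul_le_mul_of_nonneg_left (hv i) (abs_nonneg _)

theorem exists_steering_finiteControl {N : ℕ} {κ T : ℝ} (hδ : 0 < δ) (hT : 0 < T) (hκ : 0 ≤ κ)
    (hb : ∀ n, b n = φ n)
    (hc : RowsIndep (fun j : Fin N => lam j)
      fun (j : Fin N) (i : Fin M) => inner ℝ (B (ι (φ i))) (φ j : H)) :
    ∃ K ≥ 0, ∀ x : H, ∃ v : Fin M → ℝ → ℝ, (∀ i, ContDiff ℝ 2 (v i)) ∧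
      (∀ i, ∀ t ≥ T, v i t = 0) ∧
      (∀ n < N, ∫ s in (0 : ℝ)..T, inner ℝ (b n) (B (finiteControl ι φ v s)) •
        backwardOrbit (modeGen δ (lam n)) (1, 0) s = -(inner ℝ (b n) x, 0)) ∧
      ∀ i, ∀ t ≥ 0, |v i t| + |deriv (v i) t| + |deriv (deriv (v i)) t| ≤
        K * Real.exp (-κ * t) * ‖x‖ := by
  obtain ⟨K, hK₀, hK⟩ := exists_null_control hδ hT hκ hc
  refine ⟨K, hK₀, fun x => ?_⟩
  obtain ⟨v, hv, hvanish, hsteer, hbound⟩ := hK fun n => inner ℝ (b n) x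
  have hcoeff : ‖fun n : Fin N => inner ℝ (b n) x‖ ≤ ‖x‖ :=
    (pi_norm_le_iff_of_nonneg (norm_nonneg x)).mpr fun n => by
      simpa [b.orthonormal.1] using norm_inner_le_norm (𝕜 := ℝ) (b n) x
  refine ⟨v, hv, hvanish, fun n hn => ?_, fun i t ht => (hbound i t ht).trans (by gcongr)⟩
  simp only [hb, inner_map_finiteControl] at hsteer ⊢
  exact hsteer ⟨n, hn⟩

theorem exists_isModalSystem_finiteControl {N : ℕ} {R T : ℝ} {x : H} (hδ : 0 < δ)
    (hlam : ∀ n, 0 < lam n) (hb : ∀ n, b n = φ n) (hv : ∀ i, Continuous (v i))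
    (hR : ∀ i, ∀ t ≥ 0, |v i t| ≤ R) (hvanish : ∀ i, ∀ t ≥ T, v i t = 0)
    (hsteer : ∀ n < N, ∫ s in (0 : ℝ)..T, inner ℝ (b n) (B (finiteControl ι φ v s)) •
      backwardOrbit (modeGen δ (lam n)) (1, 0) s = -(inner ℝ (b n) x, 0)) :
    ∃ Y Z : ℕ → ℝ → ℝ, IsModalSystem b δ lam (fun t => B (finiteControl ι φ v t)) x
      (fun n => controlWeight B ι φ M n * R) Y Z ∧ ∀ n < N, ∀ t ≥ T, Y n t = 0 := by
  have hcont : Continuous fun t => B (finiteControl ι φ v t) :=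
    B.continuous.comp (continuous_finiteControl hv)
  have hsummable : Summable fun n => (controlWeight B ι φ M n * R) ^ 2 := by
    simpa only [mul_pow] using (summable_sq_controlWeight hb).mul_right (R ^ 2)
  refine exists_isModalSystem hδ hlam hcont hsummable (fun n t ht => ?_) (fun t ht => ?_) hsteer
  · rw [hb]
    exact abs_inner_map_finiteControl_le (fun i => hR i t ht) n
  · simp only [finiteControl, hvanish _ t ht, zero_smul, Finset.sum_const_zero, map_zero]

theorem exists_stabilizing_modalSystem {N : ℕ} {T : ℝ} (hmono : Monotone lam)
    (hlam : ∀ n, 0 < lam n) (hδ : 0 < δ) (hγ : 0 ≤ γ) (hγδ : γ ≤ 1 + δ)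
    (hsum : 0 < lam N + δ - 2 * γ) (hprod : 0 < lam N * (1 + δ - γ) + γ ^ 2 - γ * δ)
    (hT : 0 < T) (hb : ∀ n, b n = φ n)
    (hc : RowsIndep (fun j : Fin N => lam j)
      fun (j : Fin N) (i : Fin M) => inner ℝ (B (ι (φ i))) (φ j : H)) :
    ∃ C > 0, ∀ x : H, ∃ (v : Fin M → ℝ → ℝ) (G : ℕ → ℝ) (Y Z : ℕ → ℝ → ℝ),
      IsModalSystem b δ lam (fun t => B (finiteControl ι φ v t)) x G Y Z ∧
      (∀ t ≥ 0, ‖synth b fun n => Y n t‖ ≤ C * Real.exp (-γ * t) * ‖x‖) ∧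
      (∀ i, ContDiff ℝ 2 (v i)) ∧ (∀ i, ∀ t ≥ T, v i t = 0) ∧
      ∀ i, ∀ t ≥ 0, |v i t| + |deriv (v i) t| + |deriv (deriv (v i)) t| ≤
        C * Real.exp (-γ * t) * ‖x‖ := by
  obtain ⟨K₁, hK₁₀, hK₁⟩ := exists_norm_sq_synth_le_exp hmono hlam hδ hγ hγδ hsum hprod b T
  obtain ⟨K, hK₀, hK⟩ := exists_steering_finiteControl hδ hT (by positivity : 0 ≤ γ + 1) hb hc
  set S := ∑' n, controlWeight B ι φ M n ^ 2
  have hS₀ : 0 ≤ S := tsum_nonneg fun n => sq_nonneg _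
  set D := K₁ * (1 + S * K ^ 2)
  have hD₀ : 0 ≤ D :=
    mul_nonneg hK₁₀ (add_nonneg zero_le_one (mul_nonneg hS₀ (sq_nonneg K)))
  refine ⟨√D + K + 1, by positivity, fun x => ?_⟩
  obtain ⟨v, hv, hvanish, hsteer, hbound⟩ := hK x
  have hv_le : ∀ i, ∀ t ≥ 0, |v i t| ≤ K * ‖x‖ * Real.exp (-(γ + 1) * t) := fun i t ht => by
    linarith [hbound i t ht, abs_nonneg (deriv (v i) t), abs_nonneg (deriv (deriv (v i)) t)]
  have hv_bdd : ∀ i, ∀ t ≥ 0, |v i t| ≤ K * ‖x‖ := fun i t ht => (hv_le i t ht).trans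
    (mul_le_of_le_one_right (by positivity) (Real.exp_le_one_iff.mpr (by nlinarith)))
  obtain ⟨Y, Z, hm, hY⟩ := exists_isModalSystem_finiteControl hδ hlam hb
    (fun i => (hv i).continuous) hv_bdd hvanish hsteer
  refine ⟨v, _, Y, Z, hm, fun t ht => ?_, hv, hvanish, fun i t ht => (hbound i t ht).trans ?_⟩
  · have hsq := hK₁ _ x _ Y Z hm (fun n t ht => by
      rw [hb, mul_assoc]
      exact abs_inner_map_finiteControl_le (fun i => hv_le i t ht.le) n) hY t ht
    have hsq_eq : K₁ * (‖x‖ ^ 2 + ∑' n, (controlWeight B ι φ M n * (K * ‖x‖)) ^ 2)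
        * Real.exp (-(2 * γ) * t) = (√D * Real.exp (-γ * t) * ‖x‖) ^ 2 := by
      simp only [mul_pow, tsum_mul_right, Real.sq_sqrt hD₀, ← Real.exp_nat_mul, D, S]
      ring_nf
    refine (abs_le_of_sq_le_sq' (hsq.trans_eq hsq_eq) (by positivity)).2.trans ?_
    gcongr
    linarith
  · gcongr
    · linarith [Real.sqrt_nonneg D]
    · linarith

end FiniteControl

theorem exists_stabilizing_control [CompleteSpace H] (hA : IsAdmissibleOperator A)
    (hφ : IsEigenbasis A φ lam) (hδ : 0 < δ) (hγ : 0 ≤ γ) (hγδ : γ < 1 + δ) {N M : ℕ}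
    (hN : N = numUnstable δ γ lam)
    (hc : RowsIndep (fun j : Fin N => lam j)
      fun (j : Fin N) (i : Fin M) => inner ℝ (B (ι (φ i))) (φ j : H))
    {T : ℝ} (hT : 0 < T) :
    ∃ C > 0, ∀ (f : ℝ → H) (fe : H) (ye : A.domain), (∀ t ≥ 0, f t ∈ range B) → fe ∈ range B →
      (1 + 1 / δ) • A ye = fe → ∀ y₀ : H, ∃ v : Fin M → ℝ → ℝ,
        Stabilizes A B δ γ C f fe ye y₀ (finiteControl ι φ v) ∧
        (∀ i, ContDiff ℝ 2 (v i)) ∧ (∀ i, ∀ t ≥ T, v i t = 0) ∧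
        ∀ i, ∀ t ≥ 0, |v i t| + |deriv (v i) t| + |deriv (deriv (v i)) t| ≤
          C * Real.exp (-γ * t) * ‖y₀ - ye‖ := by
  obtain ⟨b, hb⟩ := hφ.exists_hilbertBasis
  obtain ⟨r, K, hK, hresolvent, -⟩ := hA.compactResolvent
  obtain ⟨hsum, hprod⟩ := lt_re_of_numUnstable hγδ (hφ.tendsto_atTop hK hresolvent)
  rw [← hN] at hsum hprod
  obtain ⟨C, hC₀, hC⟩ := exists_stabilizing_modalSystem hφ.mono (hφ.eigenvalue_pos hA.posDef) hδ hγ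
    hγδ.le hsum hprod hT hb hc
  refine ⟨C, hC₀, fun f fe ye hf hfe hye y₀ => ?_⟩
  obtain ⟨v, G, Y, Z, hm, hdecay, hv, hvanish, hbound⟩ := hC (y₀ - ye)
  have hstab := stabilizes_of_isModalSystem hA.closed hA.dense hA.selfAdjoint hφ hb hf hfe hye hm
    hdecay
  exact ⟨v, hstab, hv, hvanish, hbound⟩

section Kernel

theorem deriv_eq_zero_of_vanish {v : ℝ → ℝ} {T : ℝ} (hv : Differentiable ℝ v)
    (hvanish : ∀ t ≥ T, v t = 0) {t : ℝ} (ht : T ≤ t) : deriv v t = 0 :=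
  (uniqueDiffOn_Ici T t ht).eq_deriv _ (hv t).hasDerivAt.hasDerivWithinAt
    ((hasDerivWithinAt_const t (Ici T) (0 : ℝ)).congr hvanish (hvanish t ht))

theorem exists_kernel_density {v : ℝ → ℝ} {T : ℝ} (hδ : 0 < δ) (hv : ContDiff ℝ 1 v)
    (hvanish : ∀ t ≥ T, v t = 0) :
    ∃ w : ℝ → ℝ, Continuous w ∧ (∀ t, v t = -∫ s in t..T, beta δ (t - s) * w s) ∧
      (∀ t ≥ T, w t = 0) ∧ ∀ t, |w t| ≤ (1 + δ) * (|v t| + |deriv v t|) := by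
  have hdiff : Differentiable ℝ v := hv.differentiable one_ne_zero
  have hcont : Continuous fun t => deriv v t + δ * v t :=
    (hv.continuous_deriv le_rfl).add (continuous_const.mul hv.continuous)
  have hderiv (t s : ℝ) : HasDerivAt (fun s => beta δ (t - s) * v s)
      (beta δ (t - s) * (deriv v s + δ * v s)) s := by
    have hbeta := (hasDerivAt_beta δ (t - s)).comp s ((hasDerivAt_id s).const_sub t)
    exact (hbeta.mul (hdiff s).hasDerivAt).congr_deriv (by simp only [Function.comp]; ring)
  refine ⟨fun t => deriv v t + δ * v t, hcont, fun t => ?_, fun t ht => ?_, fun t => ?_⟩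
  · have hint : Continuous fun s => beta δ (t - s) * (deriv v s + δ * v s) :=
      ((continuous_beta δ).comp (continuous_const.sub continuous_id)).mul hcont
    rw [intervalIntegral.integral_eq_sub_of_hasDerivAt (fun s _ => hderiv t s)
      (hint.intervalIntegrable _ _), hvanish T le_rfl, sub_self, beta_zero]
    ring
  · simp only [deriv_eq_zero_of_vanish hdiff hvanish ht, hvanish t ht, mul_zero, add_zero]
  · refine (abs_add_le _ _).trans ?_
    rw [abs_mul, abs_of_pos hδ]
    nlinarith [abs_nonneg (v t), mul_nonneg hδ.le (abs_nonneg (deriv v t))]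

theorem integral_sum_sq_le {κ : Type*} [Fintype κ] {w : κ → ℝ → ℝ} {T R : ℝ} (hT : 0 ≤ T)
    (hw : ∀ i, Continuous (w i)) (hR : ∀ i, ∀ t ∈ Icc 0 T, |w i t| ≤ R) :
    ∫ t in (0 : ℝ)..T, ∑ i, |w i t| ^ 2 ≤ T * (Fintype.card κ * R ^ 2) := by
  have hle : ∀ t ∈ Icc 0 T, ∑ i, |w i t| ^ 2 ≤ Fintype.card κ * R ^ 2 := fun t ht =>
    (Finset.sum_le_sum fun i _ => pow_le_pow_left₀ (abs_nonneg _) (hR i t ht) 2).trans_eq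
      (by rw [Finset.sum_const, Finset.card_univ, nsmul_eq_mul])
  refine (intervalIntegral.integral_mono_on hT (Continuous.intervalIntegrable (by fun_prop) _ _)
    intervalIntegrable_const hle).trans_eq ?_
  rw [intervalIntegral.integral_const, smul_eq_mul, sub_zero]

theorem exists_kernel_densities {κ : Type*} [Fintype κ] {v : κ → ℝ → ℝ} {T R : ℝ} (hδ : 0 < δ)
    (hT : 0 ≤ T) (hv : ∀ i, ContDiff ℝ 1 (v i)) (hvanish : ∀ i, ∀ t ≥ T, v i t = 0)
    (hR : ∀ i, ∀ t ∈ Icc 0 T, |v i t| + |deriv (v i) t| ≤ R) :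
    ∃ w : κ → ℝ → ℝ, (∀ i, Continuous (w i)) ∧
      (∀ i t, v i t = -∫ s in t..T, beta δ (t - s) * w i s) ∧ (∀ i, ∀ t ≥ T, w i t = 0) ∧
      ∫ t in (0 : ℝ)..T, ∑ i, |w i t| ^ 2 ≤ T * (Fintype.card κ * ((1 + δ) * R) ^ 2) := by
  choose w hw hvw hw_vanish hw_le using fun i => exists_kernel_density hδ (hv i) (hvanish i)
  exact ⟨w, hw, hvw, hw_vanish, integral_sum_sq_le hT hw fun i t ht =>
    (hw_le i t).trans (mul_le_mul_of_nonneg_left (hR i t ht) (by positivity))⟩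

end Kernel

end Stabilization

end PIDE

theorem mainTheorem6_general {H U : Type*}
    [NormedAddCommGroup H] [InnerProductSpace ℝ H] [CompleteSpace H]
    [NormedAddCommGroup U] [InnerProductSpace ℝ U]
    (A : H →ₗ.[ℝ] H) (hA : PIDE.IsAdmissibleOperator A)
    (φ : ℕ → A.domain) (lam : ℕ → ℝ) (hφ : PIDE.IsEigenbasis A φ lam)
    (B : U →L[ℝ] H) (ι : A.domain →ₗ[ℝ] U)
    (δ γ : ℝ) (hδ : 0 < δ) (hγ : 0 ≤ γ) (hγδ : γ < 1 + δ)
    (N M : ℕ) (hN : N = PIDE.numUnstable δ γ lam)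
    (hc : PIDE.RowsIndep (fun j : Fin N => lam j)
      fun (j : Fin N) (i : Fin M) => inner ℝ (B (ι (φ i))) (φ j : H)) :
    (∀ T > 0, ∃ C > 0, ∀ (f : ℝ → H) (fe : H) (ye : A.domain),
      (∀ t ≥ 0, f t ∈ range B) → fe ∈ range B → (1 + 1 / δ) • A ye = fe →
      ∀ y₀ : H, ∃ v w : Fin M → ℝ → ℝ,
        PIDE.Stabilizes A B δ γ C f fe ye y₀ (PIDE.finiteControl ι φ v) ∧
        (∀ i, ContinuousOn (v i) (Ici 0)) ∧
        (∀ i, ContinuousOn (w i) (Icc 0 T)) ∧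
        (∀ i, ∀ t ∈ Ico 0 T, v i t = -∫ s in t..T, PIDE.beta δ (t - s) * w i s) ∧
        (∀ i, ∀ t ≥ T, v i t = 0 ∧ w i t = 0) ∧
        ∫ t in (0 : ℝ)..T, ∑ i, |w i t| ^ 2 ≤ C * ‖y₀ - ye‖ ^ 2) ∧
    (∃ C > 0, ∀ (f : ℝ → H) (fe : H) (ye : A.domain),
      (∀ t ≥ 0, f t ∈ range B) → fe ∈ range B → (1 + 1 / δ) • A ye = fe →
      ∀ y₀ : H, ∃ v : Fin M → ℝ → ℝ,
        PIDE.Stabilizes A B δ γ C f fe ye y₀ (PIDE.finiteControl ι φ v) ∧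
        (∀ j, ContDiffOn ℝ 2 (v j) (Ici 0)) ∧
        ∀ j, ∀ t > 0, |v j t| + |deriv (v j) t| + |deriv (deriv (v j)) t| ≤
          C * Real.exp (-γ * t) * ‖y₀ - ye‖) := by
  refine ⟨fun T hT => ?_, ?_⟩
  · obtain ⟨C, hC, h⟩ := PIDE.exists_stabilizing_control hA hφ hδ hγ hγδ hN hc hT
    refine ⟨C + T * (M * ((1 + δ) * C) ^ 2), by positivity, fun f fe ye hf hfe hye y₀ => ?_⟩
    obtain ⟨v, hstab, hv, hvanish, hbound⟩ := h f fe ye hf hfe hye y₀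
    have hv_bdd : ∀ i, ∀ t ∈ Icc 0 T, |v i t| + |deriv (v i) t| ≤ C * ‖y₀ - ye‖ := fun i t ht =>
      calc |v i t| + |deriv (v i) t| ≤ C * Real.exp (-γ * t) * ‖y₀ - ye‖ :=
            (le_add_of_nonneg_right (abs_nonneg _)).trans (hbound i t ht.1)
        _ ≤ C * 1 * ‖y₀ - ye‖ := by gcongr; exact Real.exp_le_one_iff.mpr (by nlinarith [ht.1])
        _ = C * ‖y₀ - ye‖ := by rw [mul_one]
    obtain ⟨w, hw, hvw, hw_vanish, hw_sq⟩ := PIDE.exists_kernel_densities hδ hT.le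
      (fun i => (hv i).of_le one_le_two) hvanish hv_bdd
    refine ⟨v, w, hstab.mono (le_add_of_nonneg_right (by positivity)),
      fun i => (hv i).continuous.continuousOn, fun i => (hw i).continuousOn,
      fun i t _ => hvw i t, fun i t ht => ⟨hvanish i t ht, hw_vanish i t ht⟩, ?_⟩
    rw [Fintype.card_fin] at hw_sq
    nlinarith [mul_nonneg hC.le (sq_nonneg ‖y₀ - (ye : H)‖)]
  · obtain ⟨C, hC, h⟩ := PIDE.exists_stabilizing_control hA hφ hδ hγ hγδ hN hc one_pos
    refine ⟨C, hC, fun f fe ye hf hfe hye y₀ => ?_⟩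
    obtain ⟨v, hstab, hv, -, hbound⟩ := h f fe ye hf hfe hye y₀
    exact ⟨v, hstab, fun j => (hv j).contDiffOn, fun j t ht => hbound j t ht.le⟩

theorem mainTheorem6 {H U : Type*}
    [NormedAddCommGroup H] [InnerProductSpace ℝ H] [CompleteSpace H]
    [NormedAddCommGroup U] [InnerProductSpace ℝ U] [CompleteSpace U]
    (A : H →ₗ.[ℝ] H) (hA : PIDE.IsAdmissibleOperator A)
    (φ : ℕ → A.domain) (lam : ℕ → ℝ) (hφ : PIDE.IsEigenbasis A φ lam)
    (B : U →L[ℝ] H) (ι : A.domain →ₗ[ℝ] U)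
    (δ γ : ℝ) (hδ : 0 < δ) (hγ : 0 < γ) (hγδ : γ < 1 + δ)
    (N M : ℕ) (hN : N = PIDE.numUnstable δ γ lam) (hM : M = PIDE.maxMult lam N)
    (hrank : PIDE.SemisimpleRank A B ι φ lam δ N M ∨ PIDE.JordanRank A B ι φ lam δ N M) :
    (∀ T > 0, ∃ C > 0, ∀ (f : ℝ → H) (fe : H) (ye : A.domain), PIDE.IsForcing A B δ f fe ye →
      ∀ y₀ : H, ∃ v w : Fin M → ℝ → ℝ,
        PIDE.Stabilizes A B δ γ C f fe ye y₀ (PIDE.finiteControl ι φ v) ∧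
        (∀ i, ContinuousOn (v i) (Ici 0)) ∧
        (∀ i, ContinuousOn (w i) (Icc 0 T)) ∧
        (∀ i, ∀ t ∈ Ico 0 T, v i t = -∫ s in t..T, PIDE.beta δ (t - s) * w i s) ∧
        (∀ i, ∀ t ≥ T, v i t = 0 ∧ w i t = 0) ∧
        ∫ t in (0 : ℝ)..T, ∑ i, |w i t| ^ 2 ≤ C * ‖y₀ - ye‖ ^ 2) ∧
    (∃ C > 0, ∀ (f : ℝ → H) (fe : H) (ye : A.domain), PIDE.IsForcing A B δ f fe ye →
      ∀ y₀ : H, ∃ v : Fin M → ℝ → ℝ,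
        PIDE.Stabilizes A B δ γ C f fe ye y₀ (PIDE.finiteControl ι φ v) ∧
        (∀ j, ContDiffOn ℝ 2 (v j) (Ici 0)) ∧
        ∀ j, ∀ t > 0, |v j t| + |deriv (v j) t| + |deriv (deriv (v j)) t| ≤
          C * Real.exp (-γ * t) * ‖y₀ - ye‖) := by
  have hc := (hrank.elim PIDE.SemisimpleRank.jordanRank id).rowsIndep hδ
  refine (mainTheorem6_general A hA φ lam hφ B ι δ γ hδ hγ.le hγδ N M hN hc).imp
    (fun h T hT => (h T hT).imp fun C hC => ?_) fun h => h.imp fun C hC => ?_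
  all_goals
    exact hC.imp_right fun h f fe ye hf =>
      h f fe ye hf.mem_range hf.limit_mem_range hf.equilibrium
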